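/- Let $n,p\in\mathbb N$ and let $\mathcal G=(\{1,\dots,n\},\mathcal E)$ be a strongly connected directed graph, where $(i,j)\in\mathcal E$ means that agent $j$ can send information to agent $i$ (self-loops $(i,i)$ are allowed). Let $A=(a_{ij})$ and $B=(b_{ij})$ be real $n\times n$ matrices such that $a_{ij}>0$ and $b_{ij}>0$ if $(i,j)\in\mathcal E$, $a_{ij}=b_{ij}=0$ otherwise, $\sum_{j}a_{ij}=1$ for every $i$, and $\sum_i b_{ij}=1$ for every $j$. For $\epsilon\in\mathbb R$ put $$M_\epsilon=\begin{bmatrix}A&\epsilon I\\ I-A&B-\epsilon I\end{bmatrix}\in\mathbb R^{2n\times 2n}.$$ Let $|\lambda_3|$ be the third largest modulus of the eigenvalues of $M_0$, counted with algebraic multiplicity (with $|\lambda_3|:=0$ if $n=1$), let $$\Upsilon=\frac{(1-|\lambda_3|)^n}{(20+8n)^n},$$ and assume $0<\epsilon<\Upsilon$; write $M=M_\epsilon$. Let $f_1,\dots,f_n:\mathbb R^p\to\mathbb R$ be convex, let $D\in\mathbb R$ be such that every subgradient of every $f_i$ at every point has Euclidean norm at most $D$, put $f=\sum_{i=1}^nf_i$,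 and assume that $f$ attains its minimum $f^*=\min_{x\in\mathbb R^p} f(x)$. Let $\alpha_k\ge 0$ satisfy $\sum_{k=0}^\infty\alpha_k=\infty$ and $\sum_{k=0}^\infty\alpha_k^2<\infty$. Let $\mathbf z_1^k,\dots,\mathbf z_{2n}^k\in\mathbb R^p$ ($k\ge0$) be generated, from arbitrary initial vectors $\mathbf z_1^0,\dots,\mathbf z_{2n}^0$, by $$\mathbf z_i^{k+1}=\sum_{j=1}^{2n}[M]_{ij}\,\mathbf z_j^k-\alpha_k\,\mathbf g_i^k,\qquad 1\le i\le 2n,$$ where for $1\le i\le n$ the vector $\mathbf g_i^k$ is a subgradient of $f_i$ at $\mathbf z_i^k$, and $\mathbf g_i^k=0$ for $n+1\le i\le 2n$. Then for every agent $i\in\{1,\dots,n\}$, $$\lim_{k\to\infty}f(\mathbf z_i^k)=f^*.$$ -/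

import Mathlib

open Filter Topology

/-- The in-neighbours of `i`: the agents `j` that can send information to `i`.
Convention: `G.Adj i j` says that the ordered pair `(i, j)` is an edge, i.e. that agent `j` can
send information to agent `i`.  Self-loops are allowed. -/
def inNeighbors {V : Type*} (G : Digraph V) (i : V) : Set V := {j | G.Adj i j}

/-- The out-neighbours of `j`: the agents `i` that can receive information from `j`. -/
def outNeighbors {V : Type*} (G : Digraph V) (j : V) : Set V := {i | G.Adj i j}

/-- Every agent can be reached from every agent along directed edges. -/
def IsStronglyConnectedDigraph {V : Type*} (G : Digraph V) : Prop :=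
  ∀ i j : V, Relation.ReflTransGen G.Adj i j

/-- `A = (a i j)` is row-stochastic, with `a i j > 0` exactly when `j` is an in-neighbour of `i`. -/
structure IsRowWeightMatrix {n : ℕ} (G : Digraph (Fin n)) (A : Matrix (Fin n) (Fin n) ℝ) :
    Prop where
  pos : ∀ i j, j ∈ inNeighbors G i → 0 < A i j
  zero : ∀ i j, j ∉ inNeighbors G i → A i j = 0
  row_sum : ∀ i, ∑ j, A i j = 1

/-- `B = (b i j)` is column-stochastic, with `b i j > 0` exactly when `i` is an out-neighbour
of `j`. -/
structure IsColWeightMatrix {n : ℕ} (G : Digraph (Fin n)) (B : Matrix (Fin n) (Fin n) ℝ) :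
    Prop where
  pos : ∀ i j, i ∈ outNeighbors G j → 0 < B i j
  zero : ∀ i j, i ∉ outNeighbors G j → B i j = 0
  col_sum : ∀ j, ∑ i, B i j = 1

/-- The `2n × 2n` weight matrix `M = [A, ε I; I - A, B - ε I]`. -/
def weightMatrix {n : ℕ} (A B : Matrix (Fin n) (Fin n) ℝ) (ε : ℝ) :
    Matrix (Fin n ⊕ Fin n) (Fin n ⊕ Fin n) ℝ :=
  Matrix.fromBlocks A (ε • 1) (1 - A) (B - ε • 1)

/-- The moduli of the complex eigenvalues of a real square matrix, listed with algebraic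
multiplicity in decreasing order. -/
noncomputable def eigenvalueModuli {m : Type*} [Fintype m] [DecidableEq m]
    (M : Matrix m m ℝ) : List ℝ :=
  Multiset.sort ((M.map (algebraMap ℝ ℂ)).charpoly.roots.map (fun μ => ‖μ‖)) (fun a b => a ≥ b)

/-- `|λ₃|`: the third largest modulus of an eigenvalue (with algebraic multiplicity) of the weight
matrix with `ε = 0`.  For `n ≤ 1` there is no third eigenvalue, and the value is `0`. -/
noncomputable def thirdModulus {n : ℕ} (A B : Matrix (Fin n) (Fin n) ℝ) : ℝ :=
  (eigenvalueModuli (weightMatrix A B 0)).getD 2 0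

/-- The bound `Υ = (1 - |λ₃|)ⁿ / (20 + 8 n)ⁿ` for the parameter `ε`. -/
noncomputable def epsilonBound {n : ℕ} (A B : Matrix (Fin n) (Fin n) ℝ) : ℝ :=
  1 / (20 + 8 * (n : ℝ)) ^ n * (1 - thirdModulus A B) ^ n

/-- `g` is a subgradient of `h` at `x`. -/
def IsSubgradientAt {p : ℕ} (h : EuclideanSpace ℝ (Fin p) → ℝ) (x g : EuclideanSpace ℝ (Fin p)) :
    Prop :=
  ∀ y, h x + inner ℝ g (y - x) ≤ h y

/-- The global objective `f = ∑ i, f i`. -/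
noncomputable def globalObjective {n p : ℕ} (f : Fin n → EuclideanSpace ℝ (Fin p) → ℝ)
    (x : EuclideanSpace ℝ (Fin p)) : ℝ :=
  ∑ i, f i x

/-- `z` is generated by the D-DGD iteration with step sizes `α` from an arbitrary initial state.
`z k (Sum.inl i)` is the estimate of agent `i` at time `k`, `z k (Sum.inr i)` its auxiliary
variable; the subgradient `∇f i k` used by agent `i` at time `k` is any subgradient of `f i` at its
estimate. -/
def IsDDGDSequence {n p : ℕ} (f : Fin n → EuclideanSpace ℝ (Fin p) → ℝ)
    (A B : Matrix (Fin n) (Fin n) ℝ) (ε : ℝ) (α : ℕ → ℝ)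
    (z : ℕ → Fin n ⊕ Fin n → EuclideanSpace ℝ (Fin p)) : Prop :=
  ∃ subgrad : ℕ → Fin n → EuclideanSpace ℝ (Fin p),
    (∀ k i, IsSubgradientAt (f i) (z k (Sum.inl i)) (subgrad k i)) ∧
    ∀ k i, z (k + 1) i =
      ∑ j, weightMatrix A B ε i j • z k j - α k • Sum.elim (subgrad k) (fun _ => 0) i

/-! Write `M` for the weight matrix and `P = (1/n) e 𝟙ᵀ`, where `e` is 1 on the agents' coordinates
and 0 on the auxiliary ones. Then `M e = e` and `𝟙ᵀ M = 𝟙ᵀ`. The proof rests on the fact that `M -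
P` has spectral radius below 1, so that the distance to consensus contracts geometrically up to the
subgradient perturbation.

The spectral bound uses no perturbation expansion in `ε`: eigenvalues `lam` with `1 ≤ ‖lam‖` are
excluded directly. Such an eigenvector of `M - P` has vanishing sum, hence is an eigenvector `(u,
v)` of `M`. The resolvents of `A` and `Bᵀ` at `lam`, with the Perron eigenvalue 1 split off, express
`u` up to a constant and `v` up to a multiple of the Perron vector. The remaining scalars satisfy
one linear relation, and for small `ε` everything closes to `U ≤ θ U` with `U = ∑ ‖u i‖` and `θ < 1`
(`eq_zero_of_weight_eigenvector`). An explicit threshold for `ε` needs resolvent bounds free of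
Perron vectors and eigenvector conditioning. Blaschke factors provide them
(`exists_resolvent_decomposition`): they depend only on `n` and the gap `‖lam‖ - |λ₃|`.

Consequently the consensus error is dominated by a square-summable sequence
(`exists_square_summable_bound`). The average of the states performs a subgradient step of length `α
k / n`, with subgradients evaluated at points that close to it. The errors are summable, so the
average is quasi-Fejér monotone with respect to the minimizers and converges to one of them
(`exists_minimizer_tendsto_of_quasiFejer`). Each agent follows the average, and `f` is continuous.
-/

/-! ### Resolvent bounds for contractions through Blaschke factors. -/

section BlaschkeResolvent

open Polynomial

/-- The Blaschke factor `(z - μ) / (1 - conj μ * z)` has modulus at least 1 outside the unit disc,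
so normalising it to be 1 at `lam` does not enlarge it. -/
lemma norm_one_sub_conj_mul_le {μ lam : ℂ} (hμ : ‖μ‖ ≤ 1) (hlam : 1 ≤ ‖lam‖) :
    ‖1 - (starRingEnd ℂ) μ * lam‖ ≤ ‖lam - μ‖ := by
  have key : ‖lam - μ‖ ^ 2 - ‖1 - (starRingEnd ℂ) μ * lam‖ ^ 2
      = (‖lam‖ ^ 2 - 1) * (1 - ‖μ‖ ^ 2) := by
    simp only [← Complex.normSq_eq_norm_sq, Complex.normSq_apply, Complex.sub_re, Complex.sub_im,
      Complex.mul_re, Complex.mul_im, Complex.conj_re, Complex.conj_im, Complex.one_re,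
      Complex.one_im]
    ring
  have h1 : 0 ≤ (‖lam‖ ^ 2 - 1) * (1 - ‖μ‖ ^ 2) := by
    apply mul_nonneg <;> nlinarith [norm_nonneg μ]
  exact (sq_le_sq₀ (norm_nonneg _) (norm_nonneg _)).1 (by linarith)

lemma commute_aeval {𝔸 : Type*} [Ring 𝔸] [Algebra ℂ 𝔸] {T Z : 𝔸} (h : Commute Z T) (q : ℂ[X]) : Commute Z (aeval T q) := by
  induction q using Polynomial.induction_on' with
  | add p q hp hq => rw [map_add]; exact hp.add_right hq
  | monomial n a =>
    rw [aeval_monomial]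
    exact (Algebra.commute_algebraMap_left a Z).symm.mul_right (h.pow_right n)

variable {𝔸 : Type*} [NormedRing 𝔸] [NormedAlgebra ℂ 𝔸] [CompleteSpace 𝔸] [NormOneClass 𝔸]

/-- A Blaschke factor evaluated at a contraction `T`, normalised to take the value `1` at `lam`. -/
lemma exists_blaschke_factor {T : 𝔸} (hT : ‖T‖ ≤ 1) {r : ℝ} (hr : r < 1) {lam : ℂ}
    (hlam : 1 ≤ ‖lam‖) {μ : ℂ} (hμ : ‖μ‖ ≤ r) :
    ∃ G C Y : 𝔸, G * (algebraMap ℂ 𝔸 lam - T) + C = 1 ∧ C = Y * (T - algebraMap ℂ 𝔸 μ) ∧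
      Commute G T ∧ Commute C T ∧ Commute Y T ∧ ‖C‖ ≤ 3 ∧ ‖G‖ ≤ 2 / (‖lam‖ - r) := by
  set ν := (starRingEnd ℂ) μ with hν
  have hνn : ‖ν‖ = ‖μ‖ := by simp [hν]
  have hμ1 : ‖μ‖ < 1 := hμ.trans_lt hr
  have hnn := norm_nonneg μ
  have hx : ‖ν • T‖ ≤ ‖μ‖ := by
    rw [norm_smul, hνn]; nlinarith
  have hx1 : ‖ν • T‖ < 1 := hx.trans_lt hμ1
  -- `H` is the inverse of `1 - ν T`. With `b(z) = (z - μ)/(1 - ν z)`, the witnesses are `C =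
  -- b(T)/b(lam)` and the quotient `G` of `1 - b(z)/b(lam)` by `lam - z`, evaluated at `T`.
  set H : 𝔸 := ∑' i : ℕ, (ν • T) ^ i with hH
  have hH1 : H * (1 - ν • T) = 1 := geom_series_mul_neg _ hx1
  have hH2 : (1 - ν • T) * H = 1 := mul_neg_geom_series _ hx1
  have hHn : ‖H‖ ≤ 1 / (1 - ‖μ‖) := by
    have := tsum_geometric_le_of_norm_lt_one (ν • T) hx1
    rw [norm_one] at this
    have h2 : (1 - ‖ν • T‖)⁻¹ ≤ (1 - ‖μ‖)⁻¹ := by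
      apply inv_anti₀ <;> linarith
    rw [one_div]; linarith
  have hc0 : Commute (1 - ν • T) T := (Commute.one_left T).sub_left ((Commute.refl T).smul_left ν)
  have hHc : Commute H T := by
    show H * T = T * H
    calc H * T = H * (T * ((1 - ν • T) * H)) := by rw [hH2, mul_one]
      _ = H * ((1 - ν • T) * T) * H := by rw [hc0.eq]; simp only [mul_assoc]
      _ = T * H := by rw [← mul_assoc H, hH1, one_mul]
  have hdist : ‖lam‖ - r ≤ ‖lam - μ‖ := by
    have := norm_sub_norm_le lam μ; linarith
  have hpos : 0 < ‖lam‖ - r := by linarith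
  have hne : lam - μ ≠ 0 := norm_pos_iff.1 (hpos.trans_le hdist)
  have hνμ : ‖1 - ν * μ‖ = (1 - ‖μ‖) * (1 + ‖μ‖) := by
    have : 1 - ν * μ = ((1 - ‖μ‖ ^ 2 : ℝ) : ℂ) := by
      rw [hν, mul_comm, Complex.mul_conj, Complex.normSq_eq_norm_sq]; push_cast; ring
    rw [this, Complex.norm_real, Real.norm_of_nonneg (by nlinarith)]; ring
  have hcl : ∀ a : ℂ, Commute (algebraMap ℂ 𝔸 a) T := fun a => Algebra.commutes a T
  refine ⟨((1 - ν * μ) / (lam - μ)) • H, ((1 - ν * lam) / (lam - μ)) • H * (T - algebraMap ℂ 𝔸 μ),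
    ((1 - ν * lam) / (lam - μ)) • H, ?_, rfl, hHc.smul_left _, ?_, hHc.smul_left _, ?_, ?_⟩
  · have : ((1 - ν * μ) / (lam - μ)) • H * (algebraMap ℂ 𝔸 lam - T)
        + ((1 - ν * lam) / (lam - μ)) • H * (T - algebraMap ℂ 𝔸 μ)
        = H * ((((1 - ν * μ) / (lam - μ)) • (lam • 1 - T))
          + ((1 - ν * lam) / (lam - μ)) • (T - μ • 1)) := by
      rw [mul_add, mul_smul_comm, mul_smul_comm, smul_mul_assoc, smul_mul_assoc,
        Algebra.algebraMap_eq_smul_one, Algebra.algebraMap_eq_smul_one]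
    refine this.trans (Eq.trans ?_ hH1)
    congr 1
    have e1 : (1 : 𝔸) - ν • T = (1 : ℂ) • (1 : 𝔸) + (-ν) • T := by
      rw [one_smul, neg_smul, sub_eq_add_neg]
    rw [e1]
    simp only [smul_sub, smul_smul]
    have e2 : ∀ (a b c d : ℂ), a • (1 : 𝔸) - b • T + (c • T - d • (1 : 𝔸))
        = (a - d) • (1 : 𝔸) + (c - b) • T := by
      intro a b c d; rw [sub_smul, sub_smul]; abel
    rw [e2]
    congr 2 <;> (field_simp; ring)
  · exact (hHc.smul_left _).mul_left ((Commute.refl T).sub_left (hcl μ))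
  · have hb : ‖(1 - ν * lam) / (lam - μ)‖ ≤ 1 := by
      rw [norm_div]
      exact div_le_one_of_le₀ (norm_one_sub_conj_mul_le hμ1.le hlam) (norm_nonneg _)
    -- This form carries the factor `1 - |μ|²`, which cancels the pole of `‖H‖ ≤ 1/(1 - |μ|)`. The
    -- bound 3 is therefore uniform in `μ`.
    have hfac : H * (T - algebraMap ℂ 𝔸 μ) = (1 - ν * μ) • (H * T) - algebraMap ℂ 𝔸 μ := by
      have h0 : H = 1 + ν • (H * T) := by
        rw [mul_sub, mul_one, mul_smul_comm] at hH1
        rw [← hH1]; abel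
      have h1 : H * algebraMap ℂ 𝔸 μ = μ • H := by
        rw [Algebra.algebraMap_eq_smul_one, mul_smul_comm, mul_one]
      have h2 : μ • H = algebraMap ℂ 𝔸 μ + (ν * μ) • (H * T) := by
        conv_lhs => rw [h0]
        rw [smul_add, smul_smul, Algebra.algebraMap_eq_smul_one, mul_comm μ ν]
      rw [mul_sub, h1, h2, sub_smul, one_smul]
      abel
    rw [smul_mul_assoc, norm_smul, hfac]
    have h1 : ‖(1 - ν * μ) • (H * T) - algebraMap ℂ 𝔸 μ‖ ≤ 3 := by
      refine (norm_sub_le _ _).trans ?_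
      rw [norm_smul, hνμ, norm_algebraMap']
      have h3 : ‖H * T‖ ≤ 1 / (1 - ‖μ‖) := by
        refine (norm_mul_le _ _).trans ?_
        nlinarith [norm_nonneg H]
      have h4 : (1 - ‖μ‖) * (1 + ‖μ‖) * ‖H * T‖ ≤ 1 + ‖μ‖ := by
        rw [le_div_iff₀ (by linarith)] at h3
        nlinarith
      linarith
    nlinarith [norm_nonneg ((1 - ν * μ) • (H * T) - algebraMap ℂ 𝔸 μ)]
  · rw [norm_smul, norm_div, hνμ, div_mul_eq_mul_div]
    have h1 : (1 - ‖μ‖) * (1 + ‖μ‖) * ‖H‖ ≤ 2 := by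
      rw [le_div_iff₀ (by linarith)] at hHn
      nlinarith
    gcongr

/-- Division of `1` by `lam - T` modulo the product of the `T - μ`, with bounds that only depend
on the number of the `μ`. -/
lemma exists_resolvent_decomposition {T : 𝔸} (hT : ‖T‖ ≤ 1) {r : ℝ} (hr : r < 1) {lam : ℂ}
    (hlam : 1 ≤ ‖lam‖) (R : Multiset ℂ) (hR : ∀ μ ∈ R, ‖μ‖ ≤ r) :
    ∃ S Q Y : 𝔸, S * (algebraMap ℂ 𝔸 lam - T) + Q = 1 ∧
      Q = Y * aeval T (R.map (fun μ => X - C μ)).prod ∧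
      Commute S T ∧ Commute Q T ∧ Commute Y T ∧ ‖Q‖ ≤ 3 ^ R.card ∧
      ‖S‖ ≤ (3 ^ R.card - 1) / (‖lam‖ - r) := by
  induction R using Multiset.induction_on with
  | empty => exact ⟨0, 1, 1, by simp⟩
  | cons μ R ih =>
    obtain ⟨S, Q, Y, h1, h2, hS, hQ, hY, hQn, hSn⟩ :=
      ih (fun ν hν => hR ν (Multiset.mem_cons_of_mem hν))
    obtain ⟨G, C', Z, g1, g2, hG, hC, hZ, hCn, hGn⟩ :=
      exists_blaschke_factor hT hr hlam (hR μ (Multiset.mem_cons_self _ _))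
    have hpos : 0 < ‖lam‖ - r := by linarith
    -- Substitute `1 = G (lam - T) + C'` into the old remainder `Q`. The norms of `S` then
    -- accumulate `2 · 3^j / (‖lam‖ - r)`, a geometric sum.
    refine ⟨S + Q * G, Q * C', Y * Z, ?_, ?_, hS.add_left (hQ.mul_left hG), hQ.mul_left hC,
      hY.mul_left hZ, ?_, ?_⟩
    · rw [add_mul, mul_assoc, add_assoc, ← mul_add, g1, mul_one, h1]
    · rw [Multiset.map_cons, Multiset.prod_cons, mul_comm, map_mul, h2, g2]
      simp only [map_sub, aeval_X, aeval_C]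
      have : Commute Z (aeval T (R.map (fun μ => X - C μ)).prod) :=
        commute_aeval hZ _
      rw [mul_assoc, mul_assoc, ← mul_assoc (aeval T _), ← this.eq, mul_assoc]
    · rw [Multiset.card_cons, pow_succ]
      exact (norm_mul_le _ _).trans (mul_le_mul hQn hCn (norm_nonneg _) (by positivity))
    · rw [Multiset.card_cons]
      calc ‖S + Q * G‖ ≤ ‖S‖ + ‖Q‖ * ‖G‖ :=
            (norm_add_le _ _).trans (add_le_add le_rfl (norm_mul_le _ _))
        _ ≤ (3 ^ R.card - 1) / (‖lam‖ - r) + 3 ^ R.card * (2 / (‖lam‖ - r)) := by gcongr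
        _ = (3 ^ (R.card + 1) - 1) / (‖lam‖ - r) := by field_simp; ring

end BlaschkeResolvent

/-! ### Perron–Frobenius theory for irreducible stochastic matrices. -/

section IrreducibleStochastic

open Polynomial

/-- A row-stochastic matrix whose directed graph of positive entries is strongly connected. -/
structure IsIrreducibleStochastic {ι : Type*} [Fintype ι] (T : Matrix ι ι ℝ) : Prop where
  nonneg : ∀ i j, 0 ≤ T i j
  row_sum : ∀ i, ∑ j, T i j = 1
  irreducible : ∀ i j, Relation.ReflTransGen (fun i j => 0 < T i j) i j

/-- A positive stationary distribution of a stochastic matrix. -/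
structure IsStationaryDistribution {ι : Type*} [Fintype ι] (T : Matrix ι ι ℝ) (π : ι → ℝ) :
    Prop where
  pos : ∀ i, 0 < π i
  sum_eq_one : ∑ i, π i = 1
  stationary : ∀ j, ∑ i, π i * T i j = π j

variable {ι : Type*} [Fintype ι] {T : Matrix ι ι ℝ}

namespace IsIrreducibleStochastic

lemma eq_zero_of_right_fixed (hT : IsIrreducibleStochastic T) {x : ι → ℝ} (hx : ∀ i, 0 ≤ x i)
    (hfix : ∀ i, ∑ j, T i j * x j = x i) {i₀ : ι} (h₀ : x i₀ = 0) (j : ι) : x j = 0 := by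
  induction hT.irreducible i₀ j with
  | refl => exact h₀
  | tail _ hbc ih =>
    rename_i b c _
    have h := hfix b
    rw [ih, Finset.sum_eq_zero_iff_of_nonneg
      (fun j _ => mul_nonneg (hT.nonneg _ _) (hx j))] at h
    exact (mul_eq_zero.1 (h c (Finset.mem_univ _))).resolve_left hbc.ne'

lemma eq_zero_of_left_fixed (hT : IsIrreducibleStochastic T) {y : ι → ℝ} (hy : ∀ i, 0 ≤ y i)
    (hfix : ∀ j, ∑ i, y i * T i j = y j) {j₀ : ι} (h₀ : y j₀ = 0) (i : ι) : y i = 0 := by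
  induction hT.irreducible i j₀ using Relation.ReflTransGen.head_induction_on with
  | refl => exact h₀
  | head hac _ ih =>
    rename_i a c _
    have h := hfix c
    rw [ih, Finset.sum_eq_zero_iff_of_nonneg
      (fun j _ => mul_nonneg (hy j) (hT.nonneg _ _))] at h
    exact (mul_eq_zero.1 (h a (Finset.mem_univ _))).resolve_right hac.ne'

/-- The triangle inequality gives `≤` in every coordinate. Since rows sum to 1, both sides have the
same total, so equality holds everywhere. -/
lemma norm_left_fixed (hT : IsIrreducibleStochastic T) {w : ι → ℂ}
    (hw : ∀ j, ∑ i, w i * (T i j : ℂ) = w j) (j : ι) : ∑ i, ‖w i‖ * T i j = ‖w j‖ := by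
  have hle : ∀ j ∈ Finset.univ, ‖w j‖ ≤ ∑ i, ‖w i‖ * T i j := by
    intro j _
    conv_lhs => rw [← hw j]
    refine (norm_sum_le _ _).trans (Finset.sum_le_sum fun i _ => ?_)
    rw [norm_mul, Complex.norm_real, Real.norm_of_nonneg (hT.nonneg _ _)]
  have hsum : ∑ j, ‖w j‖ = ∑ j, ∑ i, ‖w i‖ * T i j := by
    rw [Finset.sum_comm]
    simp_rw [← Finset.mul_sum, hT.row_sum, mul_one]
  exact ((Finset.sum_eq_sum_iff_of_le hle).1 hsum j (Finset.mem_univ _)).symm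

/-- As for left fixed vectors, but the totals agree only after weighting by the stationary
distribution. -/
lemma norm_right_fixed (hT : IsIrreducibleStochastic T) {π : ι → ℝ}
    (hπ : IsStationaryDistribution T π) {x : ι → ℂ}
    (hx : ∀ i, ∑ j, (T i j : ℂ) * x j = x i) (i : ι) : ∑ j, T i j * ‖x j‖ = ‖x i‖ := by
  have hle : ∀ i, ‖x i‖ ≤ ∑ j, T i j * ‖x j‖ := by
    intro i
    conv_lhs => rw [← hx i]
    refine (norm_sum_le _ _).trans (Finset.sum_le_sum fun i _ => ?_)
    rw [norm_mul, Complex.norm_real, Real.norm_of_nonneg (hT.nonneg _ _)]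
  have hle' : ∀ i ∈ Finset.univ, π i * ‖x i‖ ≤ π i * ∑ j, T i j * ‖x j‖ :=
    fun i _ => mul_le_mul_of_nonneg_left (hle i) (hπ.pos i).le
  have hsum : ∑ i, π i * ‖x i‖ = ∑ i, π i * ∑ j, T i j * ‖x j‖ := by
    simp_rw [Finset.mul_sum]
    rw [Finset.sum_comm]
    simp_rw [← mul_assoc, ← Finset.sum_mul, hπ.stationary]
  have := (Finset.sum_eq_sum_iff_of_le hle').1 hsum i (Finset.mem_univ _)
  exact (mul_left_cancel₀ (hπ.pos i).ne' this).symm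

lemma exists_stationary [Nonempty ι] (hT : IsIrreducibleStochastic T) :
    ∃ π, IsStationaryDistribution T π := by
  classical
  have hdet : (T - 1).det = 0 := by
    refine Matrix.exists_mulVec_eq_zero_iff.1 ⟨fun _ => 1, ?_, ?_⟩
    · intro h
      exact one_ne_zero (congrFun h (Classical.arbitrary ι))
    · ext i
      simp [Matrix.mulVec, dotProduct, hT.row_sum, Matrix.one_apply]
  obtain ⟨v, hv0, hv⟩ := Matrix.exists_vecMul_eq_zero_iff.2 hdet
  have hv' : ∀ j, ∑ i, v i * T i j = v j := by
    intro j
    have := congrFun hv j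
    rw [Matrix.vecMul_sub, Matrix.vecMul_one, Pi.sub_apply, Pi.zero_apply, sub_eq_zero] at this
    exact this
  have habs : ∀ j, ∑ i, |v i| * T i j = |v j| := by
    intro j
    have := hT.norm_left_fixed (w := fun i => (v i : ℂ)) (fun j => by exact_mod_cast hv' j) j
    simpa using this
  have hpos : ∀ i, 0 < |v i| := by
    intro i
    refine lt_of_le_of_ne (abs_nonneg _) fun h => hv0 (funext fun j => ?_)
    exact abs_eq_zero.1 (hT.eq_zero_of_left_fixed (fun _ => abs_nonneg _) habs h.symm j)
  have hs : 0 < ∑ i, |v i| := Finset.sum_pos (fun i _ => hpos i) Finset.univ_nonempty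
  refine ⟨fun i => |v i| / ∑ i, |v i|, fun i => div_pos (hpos i) hs, ?_, fun j => ?_⟩
  · rw [← Finset.sum_div, div_self hs.ne']
  · simp_rw [div_mul_eq_mul_div]
    rw [← Finset.sum_div, habs]

/-- Subtract the multiple of `π` that makes coordinate `j₀` vanish. The moduli of the difference
form a nonnegative fixed vector with a zero, and a zero spreads along the edges. -/
lemma left_fixed_eq (hT : IsIrreducibleStochastic T) {π : ι → ℝ}
    (hπ : IsStationaryDistribution T π) {w : ι → ℂ}
    (hw : ∀ j, ∑ i, w i * (T i j : ℂ) = w j) (j₀ j : ι) : w j = w j₀ / π j₀ * π j := by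
  have hne : (π j₀ : ℂ) ≠ 0 := by exact_mod_cast (hπ.pos j₀).ne'
  have hfix : ∀ j, ∑ i, (w i - w j₀ / π j₀ * π i) * (T i j : ℂ) = w j - w j₀ / π j₀ * π j := by
    intro j
    have h2 : ∑ i, (π i : ℂ) * (T i j : ℂ) = π j := by exact_mod_cast hπ.stationary j
    simp_rw [sub_mul, mul_assoc]
    rw [Finset.sum_sub_distrib, ← Finset.mul_sum, hw, h2]
  have h0 := hT.eq_zero_of_left_fixed (fun _ => norm_nonneg _) (hT.norm_left_fixed hfix)
    (j₀ := j₀) (by rw [div_mul_cancel₀ _ hne, sub_self, norm_zero]) j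
  exact sub_eq_zero.1 (norm_eq_zero.1 h0)

lemma right_fixed_eq (hT : IsIrreducibleStochastic T) {π : ι → ℝ}
    (hπ : IsStationaryDistribution T π) {x : ι → ℂ}
    (hx : ∀ i, ∑ j, (T i j : ℂ) * x j = x i) (i j : ι) : x i = x j := by
  have hfix : ∀ i, ∑ k, (T i k : ℂ) * (x k - x j) = x i - x j := by
    intro i
    have h2 : ∑ k, (T i k : ℂ) = 1 := by exact_mod_cast hT.row_sum i
    simp_rw [mul_sub]
    rw [Finset.sum_sub_distrib, ← Finset.sum_mul, hx, h2, one_mul]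
  have h0 := hT.eq_zero_of_right_fixed (fun _ => norm_nonneg _) (hT.norm_right_fixed hπ hfix)
    (i₀ := j) (by rw [sub_self, norm_zero]) i
  exact sub_eq_zero.1 (norm_eq_zero.1 h0)

lemma eq_vecMulVec_of_fixed [Nonempty ι] (hT : IsIrreducibleStochastic T) {π : ι → ℝ}
    (hπ : IsStationaryDistribution T π) {Q : Matrix ι ι ℂ}
    (h1 : T.map (algebraMap ℝ ℂ) * Q = Q) (h2 : Q * T.map (algebraMap ℝ ℂ) = Q) :
    ∃ κ : ℂ, ∀ i j, Q i j = κ * π j := by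
  let i₀ := Classical.arbitrary ι
  refine ⟨Q i₀ i₀ / π i₀, fun i j => ?_⟩
  have e1 : Q i j = Q i₀ j := hT.right_fixed_eq hπ (x := fun i => Q i j)
    (fun i => by simpa [Matrix.mul_apply] using congrFun (congrFun h1 i) j) i i₀
  rw [e1]
  exact hT.left_fixed_eq hπ (w := fun j => Q i₀ j)
    (fun j => by simpa [Matrix.mul_apply] using congrFun (congrFun h2 i₀) j) i₀ j

section Norm

attribute [local instance] Matrix.linftyOpNormedRing Matrix.linftyOpNormedAlgebra

variable [DecidableEq ι]

/-- The operator norm for `ℓ^∞` is the largest absolute row sum. This is why `B` is always treated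
through its transpose. -/
lemma norm_map_le (hT : IsIrreducibleStochastic T) : ‖T.map (algebraMap ℝ ℂ)‖ ≤ 1 := by
  have : ‖T.map (algebraMap ℝ ℂ)‖₊ ≤ 1 := by
    rw [Matrix.linfty_opNNNorm_def]
    refine Finset.sup_le fun i _ => ?_
    rw [← NNReal.coe_le_coe]
    push_cast
    refine le_of_eq ?_
    rw [← hT.row_sum i]
    refine Finset.sum_congr rfl fun j _ => ?_
    simp [abs_of_nonneg (hT.nonneg i j)]
  exact_mod_cast this

lemma normOneClass_matrix [Nonempty ι] : NormOneClass (Matrix ι ι ℂ) :=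
  ⟨by rw [← Matrix.diagonal_one, Matrix.linfty_opNorm_diagonal]; simp⟩

lemma one_mem_roots [Nonempty ι] (hT : IsIrreducibleStochastic T) :
    (1 : ℂ) ∈ (T.map (algebraMap ℝ ℂ)).charpoly.roots := by
  rw [mem_roots (Matrix.charpoly_monic _).ne_zero, ← Matrix.mem_spectrum_iff_isRoot_charpoly,
    spectrum.mem_iff, Matrix.isUnit_iff_isUnit_det, isUnit_iff_ne_zero, not_not]
  refine Matrix.exists_mulVec_eq_zero_iff.1 ⟨fun _ => 1, ?_, ?_⟩
  · intro h
    exact one_ne_zero (congrFun h (Classical.arbitrary ι))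
  · ext i
    have h2 : ∑ k, (T i k : ℂ) = 1 := by exact_mod_cast hT.row_sum i
    simp [Matrix.mulVec, dotProduct, h2, Matrix.one_apply]

lemma norm_le_one_of_mem_roots [Nonempty ι] (hT : IsIrreducibleStochastic T) {μ : ℂ}
    (hμ : μ ∈ (T.map (algebraMap ℝ ℂ)).charpoly.roots) : ‖μ‖ ≤ 1 := by
  rw [mem_roots (Matrix.charpoly_monic _).ne_zero, ← Matrix.mem_spectrum_iff_isRoot_charpoly] at hμ
  have : NormOneClass (Matrix ι ι ℂ) := normOneClass_matrix
  exact (spectrum.norm_le_norm_of_mem hμ).trans hT.norm_map_le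

/-- Bounds, uniform on the exterior of the unit disc, for the resolvent of `T` away from the
eigenvalue `1`. -/
lemma exists_reduced_resolvent [Nonempty ι] (hT : IsIrreducibleStochastic T) {π : ι → ℝ}
    (hπ : IsStationaryDistribution T π) {R : Multiset ℂ}
    (hR : (T.map (algebraMap ℝ ℂ)).charpoly.roots = 1 ::ₘ R) {r : ℝ} (hr : r < 1)
    (hRr : ∀ μ ∈ R, ‖μ‖ ≤ r) {lam : ℂ} (hlam : 1 ≤ ‖lam‖) :
    ∃ (S : Matrix ι ι ℂ) (κ : ℂ), Commute S (T.map (algebraMap ℝ ℂ)) ∧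
      S * (algebraMap ℂ _ lam - T.map (algebraMap ℝ ℂ)) + Matrix.of (fun _ j => κ * (π j : ℂ)) = 1 ∧
      ‖S‖ ≤ (3 ^ (Fintype.card ι - 1) - 1) / (‖lam‖ - r) := by
  have : NormOneClass (Matrix ι ι ℂ) := normOneClass_matrix
  set A := T.map (algebraMap ℝ ℂ) with hA
  have hsplit : A.charpoly = ((1 ::ₘ R).map (fun μ => X - C μ)).prod := by
    rw [← hR]
    exact (IsAlgClosed.splits A.charpoly).eq_prod_roots_of_monic (Matrix.charpoly_monic _)
  have hcard : R.card = Fintype.card ι - 1 := by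
    have h := congrArg Polynomial.natDegree hsplit
    rw [Matrix.charpoly_natDegree_eq_dim, natDegree_multiset_prod_X_sub_C_eq_card,
      Multiset.card_cons] at h
    omega
  obtain ⟨S, Q, Y, h1, h2, hS, hQ, hY, -, hSn⟩ :=
    exists_resolvent_decomposition hT.norm_map_le hr hlam R hRr
  -- `Q` contains every factor of the characteristic polynomial except `T - 1`, so Cayley–Hamilton
  -- gives `Q (T - 1) = 0`. Together with commutation this makes `Q` rank one.
  have hQT : Q * A = Q := by
    have h0 := Matrix.aeval_self_charpoly A
    rw [hsplit, Multiset.map_cons, Multiset.prod_cons, mul_comm, map_mul, map_sub, aeval_X,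
      aeval_C, map_one] at h0
    have : Q * (A - 1) = 0 := by rw [h2, mul_assoc, h0, mul_zero]
    rw [mul_sub, mul_one, sub_eq_zero] at this
    exact this
  obtain ⟨κ, hκ⟩ := hT.eq_vecMulVec_of_fixed hπ (hQ.eq.symm.trans hQT) hQT
  refine ⟨S, κ, hS, ?_, hcard ▸ hSn⟩
  rw [← h1]
  congr 1
  ext i j
  exact (hκ i j).symm

end Norm

end IsIrreducibleStochastic

end IrreducibleStochastic

/-! ### Excluding eigenvalues outside the open unit disc. -/

section SpectralGap

attribute [local instance] Matrix.linftyOpNormedRing Matrix.linftyOpNormedAlgebra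

variable {ι : Type*} [Fintype ι] [DecidableEq ι]

lemma sum_norm_row_le (S : Matrix ι ι ℂ) (i : ι) : ∑ j, ‖S i j‖ ≤ ‖S‖ := by
  have h : ∑ j, ‖S i j‖₊ ≤ ‖S‖₊ := by
    rw [Matrix.linfty_opNNNorm_def]
    exact Finset.le_sup (f := fun i => ∑ j, ‖S i j‖₊) (Finset.mem_univ i)
  simpa using NNReal.coe_le_coe.2 h

lemma sum_norm_mulVec_le (S : Matrix ι ι ℂ) {x : ι → ℂ} {c : ℝ} (hx : ∀ i, ‖x i‖ ≤ c) :
    ∑ i, ‖S.mulVec x i‖ ≤ Fintype.card ι * (‖S‖ * c) := by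
  rw [← nsmul_eq_mul]
  refine Finset.sum_le_card_nsmul _ _ _ fun i _ => ?_
  have hc : 0 ≤ c := (norm_nonneg _).trans (hx i)
  calc ‖S.mulVec x i‖ ≤ ∑ j, ‖S i j‖ * c := by
        refine (norm_sum_le _ _).trans (Finset.sum_le_sum fun j _ => ?_)
        rw [norm_mul]
        exact mul_le_mul_of_nonneg_left (hx j) (norm_nonneg _)
    _ ≤ ‖S‖ * c := by
        rw [← Finset.sum_mul]
        exact mul_le_mul_of_nonneg_right (sum_norm_row_le S i) hc

lemma sum_norm_vecMul_le (S : Matrix ι ι ℂ) (x : ι → ℂ) :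
    ∑ j, ‖Matrix.vecMul x S j‖ ≤ ‖S‖ * ∑ i, ‖x i‖ := by
  calc ∑ j, ‖Matrix.vecMul x S j‖ ≤ ∑ j, ∑ i, ‖x i‖ * ‖S i j‖ := by
        refine Finset.sum_le_sum fun j _ => (norm_sum_le _ _).trans (le_of_eq ?_)
        simp_rw [norm_mul]
    _ = ∑ i, ‖x i‖ * ∑ j, ‖S i j‖ := by
        rw [Finset.sum_comm]; simp_rw [Finset.mul_sum]
    _ ≤ ∑ i, ‖x i‖ * ‖S‖ :=
        Finset.sum_le_sum fun i _ => mul_le_mul_of_nonneg_left (sum_norm_row_le S i) (norm_nonneg _)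
    _ = ‖S‖ * ∑ i, ‖x i‖ := by rw [← Finset.sum_mul, mul_comm]

/-- From `1 ≤ |1 + w|` follows `2 Re w ≥ -|w|²`, hence `|w + s|² ≥ (1 - s)|w|²`. The limit `3/4`
turns the last factor into `1/4`. -/
lemma norm_le_two_mul_norm_add {w : ℂ} {s : ℝ} (hw : 1 ≤ ‖1 + w‖) (hs0 : 0 ≤ s)
    (hs : s ≤ 3 / 4) : ‖w‖ ≤ 2 * ‖w + s‖ := by
  have h1 : 1 ≤ ‖1 + w‖ ^ 2 := by nlinarith
  have e1 : ‖1 + w‖ ^ 2 = 1 + 2 * w.re + ‖w‖ ^ 2 := by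
    simp only [← Complex.normSq_eq_norm_sq, Complex.normSq_apply, Complex.add_re, Complex.add_im,
      Complex.one_re, Complex.one_im]
    ring
  have e2 : ‖w + s‖ ^ 2 = ‖w‖ ^ 2 + 2 * s * w.re + s ^ 2 := by
    simp only [← Complex.normSq_eq_norm_sq, Complex.normSq_apply, Complex.add_re, Complex.add_im,
      Complex.ofReal_re, Complex.ofReal_im]
    ring
  refine (sq_le_sq₀ (norm_nonneg _) (by positivity)).1 ?_
  nlinarith [sq_nonneg s, sq_nonneg ‖w‖]

/-- If the reduced resolvents of `A` and `Bᵀ` at `lam` are small compared with `1 / ε`, then `lam`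
is not an eigenvalue of the weight matrix on the hyperplane of vectors with vanishing sum. -/
lemma eq_zero_of_weight_eigenvector [Nonempty ι] {A B : Matrix ι ι ℝ}
    (hA : IsIrreducibleStochastic A) {π ρ : ι → ℝ}
    (hπ : IsStationaryDistribution A π) (hρ : IsStationaryDistribution B.transpose ρ)
    {lam : ℂ} (hlam : 1 ≤ ‖lam‖) {S S' : Matrix ι ι ℂ} {κ κ' : ℂ} {σ : ℝ}
    (hSeq : S * (algebraMap ℂ _ lam - A.map (algebraMap ℝ ℂ))
      + Matrix.of (fun _ j => κ * (π j : ℂ)) = 1) (hSn : ‖S‖ ≤ σ)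
    (hS'c : Commute S' (B.transpose.map (algebraMap ℝ ℂ)))
    (hS'eq : S' * (algebraMap ℂ _ lam - B.transpose.map (algebraMap ℝ ℂ))
      + Matrix.of (fun _ j => κ' * (ρ j : ℂ)) = 1) (hS'n : ‖S'‖ ≤ σ)
    {ε : ℝ} (hε : 0 < ε) (hε1 : Fintype.card ι * ε ≤ 3 / 4)
    (hε2 : Fintype.card ι * ε * (12 * σ + 16 * ‖lam - 1‖ * σ ^ 2) < 1) {u v : ι → ℂ}
    (hu : ∀ i, ∑ j, (A i j : ℂ) * u j + ε * v i = lam * u i)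
    (hv : ∀ i, ∑ j, (B i j : ℂ) * v j = lam * v i + (lam - 1) * u i)
    (huv : ∑ i, u i + ∑ i, v i = 0) : u = 0 ∧ v = 0 := by
  set n : ℝ := (Fintype.card ι : ℝ) with hn
  have hn0 : 0 < n := by rw [hn]; exact_mod_cast Fintype.card_pos
  set w := lam - 1 with hw
  have hσ : 0 ≤ σ := (norm_nonneg _).trans hSn
  have hπ1 : ∑ i, (π i : ℂ) = 1 := by exact_mod_cast hπ.sum_eq_one
  have hρ1 : ∑ i, (ρ i : ℂ) = 1 := by exact_mod_cast hρ.sum_eq_one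
  have hπle : ∀ i, π i ≤ 1 := fun i => hπ.sum_eq_one ▸
    Finset.single_le_sum (fun i _ => (hπ.pos i).le) (Finset.mem_univ i)
  have hπA : ∀ j, ∑ i, (π i : ℂ) * (A i j : ℂ) = π j := fun j => by
    exact_mod_cast hπ.stationary j
  have hBρ : ∀ i, ∑ j, (B i j : ℂ) * (ρ j : ℂ) = ρ i := fun i => by
    have := hρ.stationary i
    simp_rw [Matrix.transpose_apply, mul_comm (ρ _)] at this
    exact_mod_cast this
  have hA1 : ∀ i, ∑ j, (A i j : ℂ) = 1 := fun i => by exact_mod_cast hA.row_sum i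
  have hπnorm : ∀ x : ι → ℂ, ‖∑ i, (π i : ℂ) * x i‖ ≤ ∑ i, ‖x i‖ := by
    intro x
    refine (norm_sum_le _ _).trans (Finset.sum_le_sum fun i _ => ?_)
    rw [norm_mul, Complex.norm_real, Real.norm_of_nonneg (hπ.pos i).le]
    exact mul_le_of_le_one_left (norm_nonneg _) (hπle i)
  set a := ∑ i, (π i : ℂ) * u i with ha
  set b := ∑ i, v i with hb
  set c := ∑ i, (π i : ℂ) * v i with hc
  set U := ∑ i, ‖u i‖ with hU
  have hU0 : 0 ≤ U := Finset.sum_nonneg fun _ _ => norm_nonneg _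
  have hbu : ∑ i, u i = -b := by linear_combination huv
  have hbU : ‖b‖ ≤ U := by
    rw [← norm_neg, ← hbu]; exact norm_sum_le _ _
  -- the scalar relation between `a` and `c`
  have hwa : w * a = ε * c := by
    have h1 : ∑ i, (π i : ℂ) * (∑ j, (A i j : ℂ) * u j + ε * v i) = lam * a := by
      simp_rw [hu]
      rw [ha, Finset.mul_sum]
      exact Finset.sum_congr rfl fun i _ => by ring
    have h2 : ∑ i, (π i : ℂ) * ∑ j, (A i j : ℂ) * u j = a := by
      simp_rw [Finset.mul_sum]
      rw [Finset.sum_comm]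
      simp_rw [← mul_assoc, ← Finset.sum_mul, hπA]
      rfl
    have h3 : ∑ i, (π i : ℂ) * (ε * v i) = ε * c := by
      rw [hc, Finset.mul_sum]
      exact Finset.sum_congr rfl fun i _ => by ring
    simp_rw [mul_add] at h1
    rw [Finset.sum_add_distrib, h2, h3] at h1
    rw [hw]; linear_combination -h1
  -- the component of `u` in the kernel of `π`
  set u' : ι → ℂ := fun i => u i - a with hu'
  have hu'eq : u' = S.mulVec (fun i => ε * (v i - c)) := by
    have h1 : (algebraMap ℂ (Matrix ι ι ℂ) lam - A.map (algebraMap ℝ ℂ)).mulVec u'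
        = fun i => ε * (v i - c) := by
      ext i
      rw [Matrix.sub_mulVec, Algebra.algebraMap_eq_smul_one, Matrix.smul_mulVec,
        Matrix.one_mulVec]
      have : (A.map (algebraMap ℝ ℂ)).mulVec u' i = ∑ j, (A i j : ℂ) * u j - a := by
        simp only [Matrix.mulVec, dotProduct, hu', mul_sub, Finset.sum_sub_distrib,
          ← Finset.sum_mul, Matrix.map_apply, Complex.coe_algebraMap, hA1, one_mul]
      rw [Pi.sub_apply, this, Pi.smul_apply, smul_eq_mul, hu']
      linear_combination (-1 : ℂ) * hu i - hwa
    have h2 : (Matrix.of (fun (_ : ι) j => κ * (π j : ℂ))).mulVec u' = 0 := by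
      ext i
      have : ∑ j, (π j : ℂ) * u' j = 0 := by
        simp only [hu', mul_sub, Finset.sum_sub_distrib, ← Finset.sum_mul, hπ1, one_mul]
        rw [← ha, sub_self]
      simp [Matrix.mulVec, dotProduct, mul_assoc, ← Finset.mul_sum, this]
    calc u' = (1 : Matrix ι ι ℂ).mulVec u' := (Matrix.one_mulVec _).symm
      _ = _ := by rw [← hSeq, Matrix.add_mulVec, h2, add_zero, ← Matrix.mulVec_mulVec, h1]
  -- the component of `v` with vanishing sum
  set y : ι → ℂ := Matrix.vecMul (fun i => u i + b * ρ i) S' with hy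
  have hvy : ∀ i, v i = b * ρ i - w * y i := by
    set v' : ι → ℂ := fun i => v i - b * ρ i with hv'
    have h1 : Matrix.vecMul v' (algebraMap ℂ (Matrix ι ι ℂ) lam - B.transpose.map (algebraMap ℝ ℂ))
        = (-w) • (fun i => u i + b * ρ i) := by
      ext i
      rw [Matrix.vecMul_sub, Algebra.algebraMap_eq_smul_one, Matrix.vecMul_smul,
        Matrix.vecMul_one]
      have : Matrix.vecMul v' (B.transpose.map (algebraMap ℝ ℂ)) i
          = ∑ j, (B i j : ℂ) * v j - b * ρ i := by
        simp only [Matrix.vecMul, dotProduct, hv', Matrix.map_apply, Matrix.transpose_apply,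
          Complex.coe_algebraMap, sub_mul, Finset.sum_sub_distrib]
        rw [← hBρ i, Finset.mul_sum]
        congr 1 <;> exact Finset.sum_congr rfl fun _ _ => by ring
      rw [Pi.sub_apply, this, Pi.smul_apply, Pi.smul_apply, smul_eq_mul, smul_eq_mul, hv']
      rw [hv]
      ring
    have h2 : Matrix.vecMul v' (Matrix.of (fun (_ : ι) j => κ' * (ρ j : ℂ))) = 0 := by
      ext j
      have : ∑ i, v' i = 0 := by
        simp only [hv', Finset.sum_sub_distrib, ← Finset.mul_sum, hρ1, mul_one]
        rw [← hb, sub_self]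
      simp [Matrix.vecMul, dotProduct, ← Finset.sum_mul, this]
    have h3 : Commute S' (algebraMap ℂ (Matrix ι ι ℂ) lam - B.transpose.map (algebraMap ℝ ℂ)) :=
      (Algebra.commute_algebraMap_right lam S').sub_right hS'c
    have h4 : v' = (-w) • y := by
      calc v' = Matrix.vecMul v' (1 : Matrix ι ι ℂ) := (Matrix.vecMul_one _).symm
        _ = _ := by
          rw [← hS'eq, Matrix.vecMul_add, h2, add_zero, h3.eq, ← Matrix.vecMul_vecMul, h1,
            Matrix.smul_vecMul]
    intro i
    have := congrFun h4 i
    simp only [hv', Pi.smul_apply, smul_eq_mul] at this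
    linear_combination this
  -- norm estimates
  set Y := ∑ i, ‖y i‖ with hY
  set V := ∑ i, ‖v i‖ with hV
  set U' := ∑ i, ‖u' i‖ with hU'
  have hρabs : ∑ i, ‖b * (ρ i : ℂ)‖ = ‖b‖ := by
    simp_rw [norm_mul, Complex.norm_real, Real.norm_of_nonneg (hρ.pos _).le]
    rw [← Finset.mul_sum, hρ.sum_eq_one, mul_one]
  have hYU : Y ≤ 2 * σ * U := by
    calc Y ≤ ‖S'‖ * ∑ i, ‖u i + b * ρ i‖ := sum_norm_vecMul_le _ _
      _ ≤ σ * (U + ‖b‖) := by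
          refine mul_le_mul hS'n ?_ (Finset.sum_nonneg fun _ _ => norm_nonneg _) hσ
          rw [← hρabs, hU, ← Finset.sum_add_distrib]
          exact Finset.sum_le_sum fun i _ => norm_add_le _ _
      _ ≤ 2 * σ * U := by nlinarith
  have hVU : V ≤ U + ‖w‖ * Y := by
    calc V ≤ ∑ i, (‖b * (ρ i : ℂ)‖ + ‖w‖ * ‖y i‖) := by
          refine Finset.sum_le_sum fun i _ => ?_
          rw [hvy i, ← norm_mul]
          exact norm_sub_le _ _
      _ = ‖b‖ + ‖w‖ * Y := by rw [Finset.sum_add_distrib, hρabs, ← Finset.mul_sum]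
      _ ≤ _ := by linarith
  have hU'V : U' ≤ n * (σ * (ε * (2 * V))) := by
    have hbound : ∀ i, ‖(ε : ℂ) * (v i - c)‖ ≤ ε * (2 * V) := by
      intro i
      rw [norm_mul, Complex.norm_real, Real.norm_of_nonneg hε.le]
      refine mul_le_mul_of_nonneg_left ?_ hε.le
      have h1 : ‖v i‖ ≤ V :=
        Finset.single_le_sum (f := fun i => ‖v i‖) (fun i _ => norm_nonneg _) (Finset.mem_univ i)
      have h2 : ‖c‖ ≤ V := hπnorm v
      linarith [norm_sub_le (v i) c]
    have hV0 : 0 ≤ V := Finset.sum_nonneg fun _ _ => norm_nonneg _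
    calc U' ≤ n * (‖S‖ * (ε * (2 * V))) := by
          rw [hU', hu'eq]; exact sum_norm_mulVec_le S hbound
      _ ≤ _ := by gcongr
  set q := ∑ i, π i * ρ i with hq
  have hq0 : 0 < q := Finset.sum_pos (fun i _ => mul_pos (hπ.pos i) (hρ.pos i))
    Finset.univ_nonempty
  have hq1 : q ≤ 1 := by
    rw [hq, ← hρ.sum_eq_one]
    exact Finset.sum_le_sum fun i _ => mul_le_of_le_one_left (hρ.pos i).le (hπle i)
  set py := ∑ i, (π i : ℂ) * y i with hpy
  have hcq : c = b * q - w * py := by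
    have : ∀ i, (π i : ℂ) * v i = b * ((π i * ρ i : ℝ) : ℂ) - w * ((π i : ℂ) * y i) := by
      intro i; rw [hvy i]; push_cast; ring
    rw [hc, Finset.sum_congr rfl fun i _ => this i, Finset.sum_sub_distrib, ← Finset.mul_sum,
      ← Finset.mul_sum, hq, hpy]
    push_cast; rfl
  set su := ∑ i, u' i with hsu
  have hna : (n : ℂ) * a = -b - su := by
    have : su = -b - n * a := by
      simp only [hsu, hu', Finset.sum_sub_distrib, hbu, Finset.sum_const, Finset.card_univ,
        nsmul_eq_mul, hn]
      push_cast; rfl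
    rw [this]; ring
  -- Eliminating `a` and `c` leaves a factor `w` on the right. It can be cancelled against `w +
  -- nεq`, so the bound on `b` stays uniform as `lam` tends to 1, and no lower bound on `q` is
  -- needed beyond `q > 0`.
  have hkey : b * (w + ((n * ε * q : ℝ) : ℂ)) = w * (n * ε * py - su) := by
    push_cast
    linear_combination w * hna - n * hwa - n * ε * hcq
  have hsule : ‖su‖ ≤ U' := norm_sum_le _ _
  have hpyle : ‖py‖ ≤ Y := hπnorm y
  have hnq : n * ε * q ≤ 3 / 4 := by nlinarith [mul_pos hn0 hε]
  have hnq0 : 0 < n * ε * q := by positivity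
  have hY0 : 0 ≤ Y := Finset.sum_nonneg fun _ _ => norm_nonneg _
  have hU'0 : 0 ≤ U' := Finset.sum_nonneg fun _ _ => norm_nonneg _
  have hrhs : ‖(n : ℂ) * ε * py - su‖ ≤ n * ε * Y + U' := by
    refine (norm_sub_le _ _).trans (add_le_add ?_ hsule)
    rw [norm_mul, norm_mul, Complex.norm_real, Complex.norm_real, Real.norm_of_nonneg hn0.le,
      Real.norm_of_nonneg hε.le]
    gcongr
  have hbX : ‖b‖ ≤ 2 * (n * ε * Y + U') := by
    by_cases hw0 : w = 0
    · rw [hw0, zero_mul, zero_add] at hkey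
      have hb0 : b = 0 := (mul_eq_zero.1 hkey).resolve_right (by exact_mod_cast hnq0.ne')
      rw [hb0, norm_zero]; positivity
    · have h1 := norm_le_two_mul_norm_add (w := w) (s := n * ε * q)
        (by rw [hw]; simpa using hlam) hnq0.le hnq
      have h2 := congrArg norm hkey
      rw [norm_mul, norm_mul] at h2
      have hwp : 0 < ‖w‖ := norm_pos_iff.2 hw0
      refine le_of_mul_le_mul_left ?_ hwp
      calc ‖w‖ * ‖b‖ ≤ 2 * ‖w + ((n * ε * q : ℝ) : ℂ)‖ * ‖b‖ := by gcongr
        _ = 2 * (‖w‖ * ‖(n : ℂ) * ε * py - su‖) := by rw [← h2]; ring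
        _ ≤ 2 * (‖w‖ * (n * ε * Y + U')) := by gcongr
        _ = _ := by ring
  have hUle : U ≤ ‖b‖ + 2 * U' := by
    have h1 : U ≤ U' + n * ‖a‖ := by
      calc U ≤ ∑ i, (‖u' i‖ + ‖a‖) := by
            refine Finset.sum_le_sum fun i _ => ?_
            have : u i = u' i + a := by simp [hu']
            rw [this]; exact norm_add_le _ _
        _ = _ := by
            rw [Finset.sum_add_distrib, Finset.sum_const, Finset.card_univ, nsmul_eq_mul]
    have h2 : n * ‖a‖ ≤ ‖b‖ + U' := by
      have h3 := congrArg norm hna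
      rw [norm_mul, Complex.norm_real, Real.norm_of_nonneg hn0.le] at h3
      rw [h3]
      refine (norm_sub_le _ _).trans ?_
      rw [norm_neg]; linarith
    linarith
  -- Combining `hbX` and `hUle` gives `U ≤ 2nεY + 4U'`. The first term contributes `4σ`, and the
  -- second `8σ + 16‖w‖σ²`, each times `nεU`.
  have hfin : U ≤ (n * ε * (12 * σ + 16 * ‖w‖ * σ ^ 2)) * U := by
    have h1 : U' ≤ n * (σ * (ε * (2 * (U + ‖w‖ * (2 * σ * U))))) := by
      refine hU'V.trans ?_
      have : V ≤ U + ‖w‖ * (2 * σ * U) := hVU.trans (by gcongr)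
      gcongr
    have h2 : n * ε * Y ≤ n * ε * (2 * σ * U) := by gcongr
    calc U ≤ 2 * (n * ε * (2 * σ * U)) + 4 * (n * (σ * (ε * (2 * (U + ‖w‖ * (2 * σ * U)))))) := by
          linarith
      _ = _ := by ring
  have hUz : U = 0 := by nlinarith
  have hYz : Y = 0 := le_antisymm (by rw [hUz, mul_zero] at hYU; exact hYU) hY0
  have hbz : b = 0 := norm_le_zero_iff.1 (hUz ▸ hbU)
  constructor
  · ext i
    exact norm_eq_zero.1 ((Finset.sum_eq_zero_iff_of_nonneg fun _ _ => norm_nonneg _).1 hUz i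
      (Finset.mem_univ i))
  · ext i
    have : y i = 0 := norm_eq_zero.1
      ((Finset.sum_eq_zero_iff_of_nonneg fun _ _ => norm_nonneg _).1 hYz i (Finset.mem_univ i))
    rw [hvy i, hbz, this]; simp

end SpectralGap

/-! ### The threshold for `ε` and the third eigenvalue modulus. -/

section WeightMatrix

open Polynomial

variable {n : ℕ} {G : Digraph (Fin n)} {A B : Matrix (Fin n) (Fin n) ℝ}

lemma IsRowWeightMatrix.isIrreducibleStochastic (hG : IsStronglyConnectedDigraph G)
    (hA : IsRowWeightMatrix G A) : IsIrreducibleStochastic A where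
  nonneg i j := by
    by_cases h : j ∈ inNeighbors G i
    · exact (hA.pos i j h).le
    · exact (hA.zero i j h).ge
  row_sum := hA.row_sum
  irreducible i j := Relation.ReflTransGen.mono (fun a b hab => hA.pos a b hab) _ _ (hG i j)

lemma IsColWeightMatrix.isIrreducibleStochastic_transpose (hG : IsStronglyConnectedDigraph G)
    (hB : IsColWeightMatrix G B) : IsIrreducibleStochastic B.transpose where
  nonneg i j := by
    by_cases h : j ∈ outNeighbors G i
    · exact (hB.pos j i h).le
    · exact (hB.zero j i h).ge
  row_sum := hB.col_sum
  irreducible i j :=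
    Relation.ReflTransGen.mono (fun a b hab => hB.pos b a hab) _ _
      (Relation.reflTransGen_swap.2 (hG j i))

lemma charpoly_weightMatrix_zero (A B : Matrix (Fin n) (Fin n) ℝ) :
    ((weightMatrix A B 0).map (algebraMap ℝ ℂ)).charpoly
      = (A.map (algebraMap ℝ ℂ)).charpoly * (B.transpose.map (algebraMap ℝ ℂ)).charpoly := by
  rw [weightMatrix, Matrix.fromBlocks_map]
  simp only [zero_smul, sub_zero]
  rw [Matrix.map_zero _ (map_zero _), Matrix.charpoly_fromBlocks_zero₁₂, Matrix.transpose_map,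
    Matrix.charpoly_transpose]

/-- The two eigenvalues of largest modulus of `M₀` are the eigenvalue `1` of `A` and that of `B`. -/
lemma exists_roots_bounded_by_thirdModulus [Nonempty (Fin n)] (hA : IsIrreducibleStochastic A)
    (hB : IsIrreducibleStochastic B.transpose) :
    ∃ R R' : Multiset ℂ, (A.map (algebraMap ℝ ℂ)).charpoly.roots = 1 ::ₘ R ∧
      (B.transpose.map (algebraMap ℝ ℂ)).charpoly.roots = 1 ::ₘ R' ∧
      (∀ μ ∈ R, ‖μ‖ ≤ thirdModulus A B) ∧ (∀ μ ∈ R', ‖μ‖ ≤ thirdModulus A B) ∧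
      0 ≤ thirdModulus A B ∧ thirdModulus A B ≤ 1 := by
  obtain ⟨R, hR⟩ := Multiset.exists_cons_of_mem hA.one_mem_roots
  obtain ⟨R', hR'⟩ := Multiset.exists_cons_of_mem hB.one_mem_roots
  have hle : ∀ x ∈ (R + R').map (fun μ => ‖μ‖), x ≤ 1 := by
    intro x hx
    obtain ⟨μ, hμ, rfl⟩ := Multiset.mem_map.1 hx
    rcases Multiset.mem_add.1 hμ with h | h
    · exact hA.norm_le_one_of_mem_roots (hR ▸ Multiset.mem_cons_of_mem h)
    · exact hB.norm_le_one_of_mem_roots (hR' ▸ Multiset.mem_cons_of_mem h)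
  have hsort : eigenvalueModuli (weightMatrix A B 0)
      = 1 :: 1 :: Multiset.sort ((R + R').map (fun μ => ‖μ‖)) (fun a b => a ≥ b) := by
    have hs : (((weightMatrix A B 0).map (algebraMap ℝ ℂ)).charpoly.roots.map (fun μ => ‖μ‖))
        = 1 ::ₘ 1 ::ₘ (R + R').map (fun μ => ‖μ‖) := by
      rw [charpoly_weightMatrix_zero, roots_mul (mul_ne_zero (Matrix.charpoly_monic _).ne_zero
        (Matrix.charpoly_monic _).ne_zero), hR, hR']
      simp [Multiset.cons_add, Multiset.add_cons]
    rw [eigenvalueModuli, hs, Multiset.sort_cons _ _ _ ?_, Multiset.sort_cons _ _ _ hle]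
    intro b hb
    rcases Multiset.mem_cons.1 hb with rfl | hb
    · exact le_rfl
    · exact hle b hb
  -- After the two eigenvalues 1, index 2 is the head of the remaining list. The default 0 occurs
  -- for `n = 1`, where nothing remains to be bounded.
  have hthird : thirdModulus A B
      = (Multiset.sort ((R + R').map (fun μ => ‖μ‖)) (fun a b => a ≥ b)).getD 0 0 := by
    rw [thirdModulus, hsort]; rfl
  have hmem : ∀ x ∈ Multiset.sort ((R + R').map (fun μ => ‖μ‖)) (fun a b => a ≥ b),
      0 ≤ x ∧ x ≤ 1 := by
    intro x hx
    have hx := (Multiset.mem_sort _).1 hx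
    refine ⟨?_, hle x hx⟩
    obtain ⟨μ, -, rfl⟩ := Multiset.mem_map.1 hx
    exact norm_nonneg _
  have hbd : ∀ μ ∈ R + R', ‖μ‖ ≤ thirdModulus A B := by
    intro μ hμ
    have hx : ‖μ‖ ∈ Multiset.sort ((R + R').map (fun μ => ‖μ‖)) (fun a b => a ≥ b) :=
      (Multiset.mem_sort _).2 (Multiset.mem_map_of_mem _ hμ)
    have hpw := Multiset.pairwise_sort ((R + R').map (fun μ => ‖μ‖)) (fun a b => a ≥ b)
    rw [hthird]
    generalize Multiset.sort ((R + R').map (fun μ => ‖μ‖)) (fun a b => a ≥ b) = l at hx hpw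
    cases l with
    | nil => simp at hx
    | cons x l =>
      rcases List.mem_cons.1 hx with h | h
      · exact h.le
      · exact (List.pairwise_cons.1 hpw).1 _ h
  have h01 : 0 ≤ thirdModulus A B ∧ thirdModulus A B ≤ 1 := by
    rw [hthird]
    generalize Multiset.sort ((R + R').map (fun μ => ‖μ‖)) (fun a b => a ≥ b) = l at hmem
    cases l with
    | nil => simp
    | cons x l => exact hmem x List.mem_cons_self
  exact ⟨R, R', hR, hR', fun μ h => hbd μ (Multiset.mem_add.2 (Or.inl h)),
    fun μ h => hbd μ (Multiset.mem_add.2 (Or.inr h)), h01.1, h01.2⟩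

/-- Here `44 = 12 + 2 · 16` collects the constants of the smallness condition, and `36` is the least
value of `20 + 8n` for `n ≥ 2`. -/
lemma mul_nine_pow_le_aux (m : ℕ) :
    44 * ((m + 2 : ℕ) : ℝ) * 9 ^ (m + 1) ≤ 36 ^ (m + 2) := by
  have h : ((m + 2 : ℕ) : ℝ) ≤ 2 * 4 ^ m := by
    have : m + 2 ≤ 2 * 4 ^ m := by
      induction m with
      | zero => norm_num
      | succ k ih => rw [pow_succ]; omega
    exact_mod_cast this
  have e : (36 : ℝ) ^ (m + 2) = 144 * (4 ^ m * 9 ^ (m + 1)) := by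
    rw [show (36 : ℝ) = 4 * 9 by norm_num, mul_pow]; ring
  have h9 : (0 : ℝ) < 9 ^ (m + 1) := by positivity
  rw [e]
  nlinarith [mul_le_mul_of_nonneg_right h h9.le, mul_pos (pow_pos (by norm_num : (0:ℝ) < 4) m) h9]

/-- The smallness of `ε` expressed through the bound for the reduced resolvents. -/
lemma smallness_of_lt_bound [Nonempty (Fin n)] {ε r x : ℝ} (hε : 0 < ε) (hr0 : 0 ≤ r) (hr1 : r < 1)
    (hεr : ε < 1 / (20 + 8 * (n : ℝ)) ^ n * (1 - r) ^ n) (hx : 1 ≤ x) :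
    n * ε ≤ 3 / 4 ∧
    n * ε * (12 * ((3 ^ (n - 1) - 1) / (x - r))
      + 16 * (x + 1) * ((3 ^ (n - 1) - 1) / (x - r)) ^ 2) < 1 := by
  have hn : 0 < n := Fin.pos_iff_nonempty.2 inferInstance
  have hδ0 : 0 < 1 - r := by linarith
  have hδ1 : 1 - r ≤ 1 := by linarith
  rw [div_mul_eq_mul_div, one_mul, lt_div_iff₀ (by positivity)] at hεr
  constructor
  · have h1 : (20 + 8 * (n : ℝ)) ≤ (20 + 8 * (n : ℝ)) ^ n :=
      le_self_pow₀ (by nlinarith [Nat.cast_nonneg (α := ℝ) n]) hn.ne'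
    have h2 : (1 - r) ^ n ≤ 1 := pow_le_one₀ hδ0.le hδ1
    nlinarith [mul_le_mul_of_nonneg_left h1 hε.le]
  -- The estimate consumes `(1 - r)²`, which `(1 - r)^n` supplies only for `n ≥ 2`. For `n = 1` the
  -- resolvent bound is zero.
  · obtain ⟨m, rfl⟩ | rfl : (∃ m, n = m + 2) ∨ n = 1 := by
      rcases Nat.lt_or_ge n 2 with h | h
      · right; omega
      · left; exact ⟨n - 2, by omega⟩
    · set δ := 1 - r with hδ
      set N : ℝ := ((m + 2 : ℕ) : ℝ) with hN
      have hN2 : 2 ≤ N := by rw [hN]; push_cast; linarith [Nat.cast_nonneg (α := ℝ) m]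
      have hm : m + 2 - 1 = m + 1 := by omega
      rw [hm]
      set K : ℝ := 3 ^ (m + 1) - 1 with hK
      have h3 : (1 : ℝ) ≤ 3 ^ (m + 1) := one_le_pow₀ (by norm_num)
      have hK0 : 0 ≤ K := by linarith
      have hKsq : K ^ 2 ≤ 9 ^ (m + 1) := by
        rw [show (9 : ℝ) = 3 ^ 2 by norm_num, ← pow_mul, mul_comm 2, pow_mul]
        gcongr; linarith
      have hKle : K ≤ 9 ^ (m + 1) := by
        have : (3 : ℝ) ^ (m + 1) ≤ 9 ^ (m + 1) := by gcongr; norm_num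
        linarith
      have hxr : δ ≤ x - r := by linarith
      have hxr0 : 0 < x - r := by linarith
      have t1 : K / (x - r) ≤ 9 ^ (m + 1) / δ ^ 2 := by
        calc K / (x - r) ≤ 9 ^ (m + 1) / δ := by gcongr
          _ ≤ 9 ^ (m + 1) / δ ^ 2 := by
            gcongr
            nlinarith
      have t2 : (x + 1) * (K / (x - r)) ^ 2 ≤ 2 * (9 ^ (m + 1) / δ ^ 2) := by
        have h1 : (x + 1) / (x - r) ^ 2 ≤ 2 / δ ^ 2 := by
          rw [div_le_div_iff₀ (by positivity) (by positivity)]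
          nlinarith [mul_nonneg (sub_nonneg.2 hx) hδ0.le, sq_nonneg (x - 1)]
        calc (x + 1) * (K / (x - r)) ^ 2 = K ^ 2 * ((x + 1) / (x - r) ^ 2) := by
              rw [div_pow]; ring
          _ ≤ 9 ^ (m + 1) * (2 / δ ^ 2) := by gcongr
          _ = _ := by ring
      have hδpow : δ ^ (m + 2) ≤ δ ^ 2 := pow_le_pow_of_le_one hδ0.le hδ1 (by omega)
      have h36 : (36 : ℝ) ^ (m + 2) ≤ (20 + 8 * N) ^ (m + 2) := by gcongr; linarith
      have hε2 : ε * (44 * N * 9 ^ (m + 1)) < δ ^ 2 := by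
        calc ε * (44 * N * 9 ^ (m + 1)) ≤ ε * (20 + 8 * N) ^ (m + 2) := by
              gcongr; exact (mul_nine_pow_le_aux m).trans h36
          _ < δ ^ (m + 2) := hεr
          _ ≤ δ ^ 2 := hδpow
      calc N * ε * (12 * (K / (x - r)) + 16 * (x + 1) * (K / (x - r)) ^ 2)
          ≤ N * ε * (12 * (9 ^ (m + 1) / δ ^ 2) + 16 * (2 * (9 ^ (m + 1) / δ ^ 2))) := by
            rw [mul_assoc 16]; gcongr
        _ = ε * (44 * N * 9 ^ (m + 1)) / δ ^ 2 := by ring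
        _ < 1 := by rw [div_lt_one (by positivity)]; exact hε2
    · norm_num

end WeightMatrix

/-! ### Geometric decay of matrix powers. -/

section PowerDecay

attribute [local instance] Matrix.linftyOpNormedRing Matrix.linftyOpNormedAlgebra

/-- Gelfand's formula gives the bound for all large `k`. The finitely many earlier powers are
absorbed into the constant. -/
lemma exists_pow_norm_le_of_spectralRadius_lt_one {𝔸 : Type*} [NormedRing 𝔸] [NormedAlgebra ℂ 𝔸]
    [CompleteSpace 𝔸] {a : 𝔸} (ha : spectralRadius ℂ a < 1) :
    ∃ C γ : ℝ, 0 ≤ C ∧ 0 < γ ∧ γ < 1 ∧ ∀ k, ‖a ^ k‖ ≤ C * γ ^ k := by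
  obtain ⟨γ, hγ, hγ1⟩ := ENNReal.lt_iff_exists_nnreal_btwn.1 ha
  have hγ0 : 0 < γ := by
    rw [← ENNReal.coe_pos]; exact bot_le.trans_lt hγ
  have hev := ((spectrum.pow_nnnorm_pow_one_div_tendsto_nhds_spectralRadius a).eventually_lt_const
    hγ).and (eventually_gt_atTop 0)
  obtain ⟨K, hK⟩ := eventually_atTop.1 hev
  have hlarge : ∀ k, K ≤ k → ‖a ^ k‖ ≤ (γ : ℝ) ^ k := by
    intro k hk
    obtain ⟨h1, h2⟩ := hK k hk
    have hk0 : (0 : ℝ) < k := by exact_mod_cast h2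
    have h3 := ENNReal.rpow_lt_rpow h1 hk0
    rw [← ENNReal.rpow_mul, one_div, inv_mul_cancel₀ hk0.ne', ENNReal.rpow_one,
      ENNReal.rpow_natCast] at h3
    have h4 : ‖a ^ k‖₊ < γ ^ k := by exact_mod_cast h3
    exact_mod_cast h4.le
  have hγ0' : (0 : ℝ) < γ := by exact_mod_cast hγ0
  have hnn : ∀ k ∈ Finset.range K, 0 ≤ ‖a ^ k‖ / (γ : ℝ) ^ k := fun k _ => by positivity
  refine ⟨1 + ∑ k ∈ Finset.range K, ‖a ^ k‖ / (γ : ℝ) ^ k, γ,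
    add_nonneg zero_le_one (Finset.sum_nonneg hnn), hγ0', by exact_mod_cast hγ1, fun k => ?_⟩
  have hs := Finset.sum_nonneg hnn
  have hp : 0 < (γ : ℝ) ^ k := by positivity
  rcases Nat.lt_or_ge k K with hk | hk
  · have h1 := Finset.single_le_sum hnn (Finset.mem_range.2 hk)
    rw [div_le_iff₀ hp] at h1
    nlinarith
  · have := hlarge k hk
    nlinarith

lemma exists_pow_entry_le {m : Type*} [Fintype m] [DecidableEq m] [Nonempty m] {N : Matrix m m ℝ}
    (hN : ∀ lam : ℂ, 1 ≤ ‖lam‖ → ∀ x : m → ℂ, (∀ i, ∑ j, (N i j : ℂ) * x j = lam * x i) → x = 0) :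
    ∃ C γ : ℝ, 0 ≤ C ∧ 0 < γ ∧ γ < 1 ∧ ∀ k i j, |(N ^ k) i j| ≤ C * γ ^ k := by
  set a : Matrix m m ℂ := N.map (algebraMap ℝ ℂ) with ha
  have hrad : spectralRadius ℂ a < 1 := by
    have : spectralRadius ℂ a < ((1 : NNReal) : ENNReal) := by
      refine spectrum.spectralRadius_lt_of_forall_lt a fun lam hlam => ?_
      by_contra hcon
      have h1 : 1 ≤ ‖lam‖ := by exact_mod_cast not_lt.1 hcon
      rw [spectrum.mem_iff, Matrix.isUnit_iff_isUnit_det, isUnit_iff_ne_zero, not_not] at hlam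
      obtain ⟨x, hx0, hx⟩ := Matrix.exists_mulVec_eq_zero_iff.2 hlam
      refine hx0 (hN lam h1 x fun i => ?_)
      have := congrFun hx i
      rw [Matrix.sub_mulVec, Algebra.algebraMap_eq_smul_one, Matrix.smul_mulVec,
        Matrix.one_mulVec, Pi.sub_apply, Pi.smul_apply, smul_eq_mul, Pi.zero_apply,
        sub_eq_zero] at this
      rw [this]
      rfl
    simpa using this
  obtain ⟨C, γ, hC, hγ0, hγ1, h⟩ := exists_pow_norm_le_of_spectralRadius_lt_one hrad
  refine ⟨C, γ, hC, hγ0, hγ1, fun k i j => le_trans ?_ (h k)⟩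
  have e : a ^ k = (N ^ k).map (algebraMap ℝ ℂ) :=
    (map_pow (algebraMap ℝ ℂ).mapMatrix N k).symm
  have h1 : |(N ^ k) i j| = ‖(a ^ k) i j‖ := by
    rw [e]; simp
  rw [h1]
  exact (Finset.single_le_sum (f := fun j => ‖(a ^ k) i j‖) (fun _ _ => norm_nonneg _)
    (Finset.mem_univ j)).trans (sum_norm_row_le _ i)

end PowerDecay

/-! ### Spectral radius of the weight matrix off the consensus direction. -/

section ConsensusError

variable {n : ℕ} {G : Digraph (Fin n)} {A B : Matrix (Fin n) (Fin n) ℝ}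

/-- The matrix of the projection onto the consensus direction along the vectors of sum zero. -/
noncomputable def consensusProjection (n : ℕ) : Matrix (Fin n ⊕ Fin n) (Fin n ⊕ Fin n) ℝ :=
  Matrix.of fun i _ => Sum.elim (fun _ => 1 / (n : ℝ)) (fun _ => 0) i

lemma sum_weightMatrix_col (hB : ∀ j, ∑ i, B i j = 1) (ε : ℝ) (j : Fin n ⊕ Fin n) :
    ∑ i, weightMatrix A B ε i j = 1 := by
  rw [Fintype.sum_sum_type]
  rcases j with j | j
  · simp [weightMatrix, Matrix.one_apply]
  · simp [weightMatrix, hB]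

lemma sum_weightMatrix_inl_row (hA : ∀ i, ∑ j, A i j = 1) (ε : ℝ) (i : Fin n ⊕ Fin n) :
    ∑ j, weightMatrix A B ε i (Sum.inl j) = Sum.elim (fun _ => 1) (fun _ => 0) i := by
  rcases i with i | i
  · simp [weightMatrix, hA]
  · simp [weightMatrix, hA, Matrix.one_apply]

lemma consensus_error_no_unstable_eigenvector [Nonempty (Fin n)] (hA : IsIrreducibleStochastic A)
    (hB : IsIrreducibleStochastic B.transpose) {ε : ℝ} (hε : 0 < ε) (hε' : ε < epsilonBound A B)
    {lam : ℂ} (hlam : 1 ≤ ‖lam‖) {x : Fin n ⊕ Fin n → ℂ}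
    (hx : ∀ i, ∑ j, (((weightMatrix A B ε - consensusProjection n) i j : ℝ) : ℂ) * x j
      = lam * x i) : x = 0 := by
  have hn : (n : ℝ) ≠ 0 := by
    exact_mod_cast (Fin.pos_iff_nonempty.2 inferInstance : 0 < n).ne'
  obtain ⟨π, hπ⟩ := hA.exists_stationary
  obtain ⟨ρ, hρ⟩ := hB.exists_stationary
  obtain ⟨R, R', hR, hR', hRb, hR'b, h0, h1⟩ := exists_roots_bounded_by_thirdModulus hA hB
  -- If `|λ₃| = 1`, the threshold is zero and admits no positive `ε`.
  have h1' : thirdModulus A B < 1 := by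
    refine lt_of_le_of_ne h1 fun h => ?_
    rw [epsilonBound, h, sub_self, zero_pow (by exact_mod_cast hn), mul_zero] at hε'
    exact lt_asymm hε hε'
  obtain ⟨S, κ, -, hS, hSn⟩ := hA.exists_reduced_resolvent hπ hR h1' hRb hlam
  obtain ⟨S', κ', hSc', hS', hSn'⟩ := hB.exists_reduced_resolvent hρ hR' h1' hR'b hlam
  rw [Fintype.card_fin] at hSn hSn'
  obtain ⟨hs1, hs2⟩ := smallness_of_lt_bound hε h0 h1' hε' hlam
  have hdef : ∀ i, ∑ j, (weightMatrix A B ε i j : ℂ) * x j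
      - (Sum.elim (fun _ => 1 / (n : ℂ)) (fun _ => 0) i) * ∑ j, x j = lam * x i := by
    intro i
    rw [← hx i, Finset.mul_sum, ← Finset.sum_sub_distrib]
    refine Finset.sum_congr rfl fun j _ => ?_
    rcases i with i | i <;> simp [consensusProjection, sub_mul]
  -- The columns of `M - P` sum to 0, so summing the eigenvalue equation gives `lam * ∑ x = 0`.
  have hsum0 : ∑ j, x j = 0 := by
    have h2 : ∑ i, lam * x i = 0 := by
      rw [← Finset.sum_congr rfl fun i _ => hdef i, Finset.sum_sub_distrib, ← Finset.sum_mul,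
        Finset.sum_comm]
      have h3 : ∀ j, ∑ i, (weightMatrix A B ε i j : ℂ) = 1 := fun j => by
        exact_mod_cast sum_weightMatrix_col hB.row_sum ε j
      simp_rw [← Finset.sum_mul, h3]
      have h4 : ∑ i : Fin n ⊕ Fin n, (Sum.elim (fun _ => 1 / (n : ℂ)) (fun _ => 0) i : ℂ) = 1 := by
        rw [Fintype.sum_sum_type]
        have : (n : ℂ) ≠ 0 := by exact_mod_cast hn
        simp [this]
      rw [h4]; simp
    rw [← Finset.mul_sum] at h2
    refine (mul_eq_zero.1 h2).resolve_left fun h => ?_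
    rw [h, norm_zero] at hlam
    linarith
  simp only [hsum0, mul_zero, sub_zero] at hdef
  have hone : ∀ i, ∑ j, (((1 : Matrix (Fin n) (Fin n) ℝ) i j : ℝ) : ℂ) * x (Sum.inr j)
      = x (Sum.inr i) := fun i => by
    simp [Matrix.one_apply, apply_ite Complex.ofReal]
  have hone' : ∀ i, ∑ j, (((1 : Matrix (Fin n) (Fin n) ℝ) i j : ℝ) : ℂ) * x (Sum.inl j)
      = x (Sum.inl i) := fun i => by
    simp [Matrix.one_apply, apply_ite Complex.ofReal]
  have hu : ∀ i, ∑ j, (A i j : ℂ) * x (Sum.inl j) + ε * x (Sum.inr i) = lam * x (Sum.inl i) := by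
    intro i
    rw [← hdef, Fintype.sum_sum_type, ← hone i, Finset.mul_sum]
    simp [weightMatrix, mul_assoc]
  have hv : ∀ i, ∑ j, (B i j : ℂ) * x (Sum.inr j)
      = lam * x (Sum.inr i) + (lam - 1) * x (Sum.inl i) := by
    intro i
    have h2 := hdef (Sum.inr i)
    rw [Fintype.sum_sum_type] at h2
    simp only [weightMatrix, Matrix.fromBlocks_apply₂₁, Matrix.fromBlocks_apply₂₂,
      Matrix.sub_apply, Matrix.smul_apply, smul_eq_mul, Complex.ofReal_sub, Complex.ofReal_mul,
      sub_mul, Finset.sum_sub_distrib, mul_assoc, ← Finset.mul_sum, hone, hone'] at h2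
    -- Adding the two block equations cancels both `A u` and `ε v`.
    linear_combination h2 + hu i
  have hσ0 : 0 ≤ ((3 : ℝ) ^ (n - 1) - 1) / (‖lam‖ - thirdModulus A B) := by
    have h3 : (1 : ℝ) ≤ 3 ^ (n - 1) := one_le_pow₀ (by norm_num)
    exact div_nonneg (by linarith) (by linarith)
  obtain ⟨hu0, hv0⟩ := eq_zero_of_weight_eigenvector hA hπ hρ hlam hS hSn hSc' hS' hSn' hε
    (by rw [Fintype.card_fin]; exact hs1)
    (by
      rw [Fintype.card_fin]
      refine lt_of_le_of_lt ?_ hs2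
      have : ‖lam - 1‖ ≤ ‖lam‖ + 1 := by simpa using norm_sub_le lam 1
      gcongr)
    (u := fun i => x (Sum.inl i)) (v := fun i => x (Sum.inr i)) hu hv
    (by rw [← Fintype.sum_sum_type]; exact hsum0)
  ext (i | i)
  · exact congrFun hu0 i
  · exact congrFun hv0 i

/-- The powers of the weight matrix converge geometrically to the consensus projection. -/
lemma exists_consensus_error_pow_le [Nonempty (Fin n)] (hG : IsStronglyConnectedDigraph G)
    (hA : IsRowWeightMatrix G A) (hB : IsColWeightMatrix G B) {ε : ℝ} (hε : 0 < ε)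
    (hε' : ε < epsilonBound A B) :
    ∃ C γ : ℝ, 0 ≤ C ∧ 0 < γ ∧ γ < 1 ∧
      ∀ k i j, |((weightMatrix A B ε - consensusProjection n) ^ k) i j| ≤ C * γ ^ k :=
  exists_pow_entry_le fun _ hlam _ hx => consensus_error_no_unstable_eigenvector
    (hA.isIrreducibleStochastic hG) (hB.isIrreducibleStochastic_transpose hG) hε hε' hlam hx

end ConsensusError

/-! ### Existence of subgradients and the Lipschitz bound. -/

section Subgradient

variable {p : ℕ}

/-- Separate `(x, h x)` from the open strict epigraph. The functional has negative vertical
component `c`, so its horizontal part divided by `-c` is a subgradient. -/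
lemma ConvexOn.exists_isSubgradientAt {h : EuclideanSpace ℝ (Fin p) → ℝ}
    (hh : ConvexOn ℝ Set.univ h) (x : EuclideanSpace ℝ (Fin p)) :
    ∃ g, IsSubgradientAt h x g := by
  have hcont : Continuous h := hh.locallyLipschitz.continuous
  have hopen : IsOpen {q : EuclideanSpace ℝ (Fin p) × ℝ | h q.1 < q.2} :=
    isOpen_lt (hcont.comp continuous_fst) continuous_snd
  have hconv : Convex ℝ {q : EuclideanSpace ℝ (Fin p) × ℝ | h q.1 < q.2} := by
    simpa using hh.convex_strict_epigraph
  obtain ⟨L, hL⟩ := geometric_hahn_banach_open_point hconv hopen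
    (x := (x, h x)) (by simp)
  set ℓ : EuclideanSpace ℝ (Fin p) →L[ℝ] ℝ := L.comp (ContinuousLinearMap.inl ℝ _ ℝ) with hℓ
  set c : ℝ := L (0, 1) with hc
  have hsplit : ∀ y t, L (y, t) = ℓ y + t * c := by
    intro y t
    have : ((y, t) : EuclideanSpace ℝ (Fin p) × ℝ) = (y, 0) + t • (0, 1) := by simp
    rw [this, map_add, map_smul, smul_eq_mul]
    rfl
  have hlt : ∀ y t, h y < t → ℓ y + t * c < ℓ x + h x * c := by
    intro y t ht
    have := hL (y, t) ht
    rwa [hsplit, hsplit] at this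
  have hc0 : c < 0 := by
    have := hlt x (h x + 1) (by linarith)
    nlinarith
  have hle : ∀ y, ℓ y + h y * c ≤ ℓ x + h x * c := by
    intro y
    refine le_of_forall_pos_lt_add fun δ hδ => ?_
    have := hlt y (h y + δ / (-c)) (by
      have := div_pos hδ (neg_pos.2 hc0); linarith)
    have e : δ / (-c) * c = -δ := by
      have := hc0.ne
      field_simp
    rw [add_mul, e] at this
    linarith
  refine ⟨(InnerProductSpace.toDual ℝ _).symm ((-c)⁻¹ • ℓ), fun y => ?_⟩
  rw [InnerProductSpace.toDual_symm_apply, _root_.smul_apply, smul_eq_mul, map_sub]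
  have h1 := hle y
  have h2 : (-c)⁻¹ * (ℓ y - ℓ x) ≤ h y - h x := by
    rw [inv_mul_le_iff₀ (neg_pos.2 hc0)]
    linarith
  linarith

lemma ConvexOn.sub_le_of_subgradient_norm_le {h : EuclideanSpace ℝ (Fin p) → ℝ}
    (hh : ConvexOn ℝ Set.univ h) {D : ℝ} (hD : ∀ x g, IsSubgradientAt h x g → ‖g‖ ≤ D)
    (x y : EuclideanSpace ℝ (Fin p)) : h x - h y ≤ D * ‖x - y‖ := by
  obtain ⟨g, hg⟩ := hh.exists_isSubgradientAt x
  have h1 := hg y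
  have h2 := abs_real_inner_le_norm g (y - x)
  have h3 : ‖g‖ * ‖y - x‖ ≤ D * ‖x - y‖ := by
    rw [norm_sub_rev y x]
    exact mul_le_mul_of_nonneg_right (hD x g hg) (norm_nonneg _)
  linarith [neg_abs_le (inner ℝ g (y - x))]

end Subgradient

/-! ### Square-summability under perturbed contractions. -/

section PerturbedContraction

/-- Convexity of the square, applied to `γ s + (1 - γ) (β / (1 - γ))`, gives `hstep`, which is then
summed. -/
lemma summable_sq_of_affine_recursion {γ : ℝ} (hγ0 : 0 ≤ γ) (hγ1 : γ < 1) {s β : ℕ → ℝ}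
    (hs : ∀ k, s (k + 1) = γ * s k + β k) (hβ : Summable fun k => β k ^ 2) :
    Summable fun k => s k ^ 2 := by
  have hstep : ∀ k, s (k + 1) ^ 2 ≤ γ * s k ^ 2 + β k ^ 2 / (1 - γ) := by
    intro k
    have h1 : 0 < 1 - γ := by linarith
    rw [hs, ← sub_nonneg]
    have : γ * s k ^ 2 + β k ^ 2 / (1 - γ) - (γ * s k + β k) ^ 2
        = γ / (1 - γ) * ((1 - γ) * s k - β k) ^ 2 := by
      field_simp; ring
    rw [this]
    positivity
  have hsum : ∀ K, (1 - γ) * ∑ k ∈ Finset.range K, s k ^ 2 + s K ^ 2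
      ≤ s 0 ^ 2 + ∑ k ∈ Finset.range K, β k ^ 2 / (1 - γ) := by
    intro K
    induction K with
    | zero => simp
    | succ K ih =>
      rw [Finset.sum_range_succ, Finset.sum_range_succ]
      linarith [hstep K]
  refine summable_of_sum_range_le (c := (s 0 ^ 2 + ∑' k, β k ^ 2 / (1 - γ)) / (1 - γ))
    (fun _ => sq_nonneg _) fun K => ?_
  rw [le_div_iff₀ (by linarith)]
  have h1 := (hβ.div_const (1 - γ)).sum_le_tsum (Finset.range K)
    (fun k _ => div_nonneg (sq_nonneg _) (by linarith))
  linarith [hsum K, sq_nonneg (s K)]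

lemma exists_square_summable_bound {ι E : Type*} [Fintype ι] [DecidableEq ι]
    [NormedAddCommGroup E] [NormedSpace ℝ E] {N : Matrix ι ι ℝ} {C γ : ℝ} (hC : 0 ≤ C)
    (hγ0 : 0 < γ) (hγ1 : γ < 1) (hN : ∀ k i j, |(N ^ k) i j| ≤ C * γ ^ k) {e h : ℕ → ι → E}
    {α : ℕ → ℝ} (hα : ∀ k, 0 ≤ α k) (hα2 : Summable fun k => α k ^ 2)
    (he : ∀ k i, e (k + 1) i = ∑ j, N i j • e k j - α k • h k i) {H : ℝ} (hH0 : 0 ≤ H)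
    (hH : ∀ k, ∑ j, ‖h k j‖ ≤ H) :
    ∃ s : ℕ → ℝ, (∀ k, 0 ≤ s k) ∧ (Summable fun k => s k ^ 2) ∧ ∀ k i, ‖e k i‖ ≤ s k := by
  let s : ℕ → ℝ := fun k => Nat.rec (∑ j, ‖e 0 j‖) (fun k t => γ * t + H * α k) k
  have hs : ∀ k, s (k + 1) = γ * s k + H * α k := fun k => rfl
  have hs0 : ∀ k, 0 ≤ s k := by
    intro k
    induction k with
    | zero => exact Finset.sum_nonneg fun _ _ => norm_nonneg _
    | succ k ih => rw [hs]; have := hα k; positivity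
  have hmat : ∀ (m : ℕ) (x : ι → E) i, ‖∑ j, (N ^ m) i j • x j‖ ≤ C * γ ^ m * ∑ j, ‖x j‖ := by
    intro m x i
    rw [Finset.mul_sum]
    refine (norm_sum_le _ _).trans (Finset.sum_le_sum fun j _ => ?_)
    rw [norm_smul, Real.norm_eq_abs]
    exact mul_le_mul_of_nonneg_right (hN m i j) (norm_nonneg _)
  -- Because of `C`, a single step need not contract in norm. Bounding all `N^m e_k` at once keeps
  -- `C` from compounding, and `m = 0` is the desired case.
  have key : ∀ k m i, ‖∑ j, (N ^ m) i j • e k j‖ ≤ C * γ ^ m * s k := by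
    intro k
    induction k with
    | zero => exact fun m i => hmat m _ i
    | succ k ih =>
      intro m i
      have e1 : ∑ j, (N ^ m) i j • e (k + 1) j
          = ∑ l, (N ^ (m + 1)) i l • e k l - α k • ∑ j, (N ^ m) i j • h k j := by
        simp_rw [he, smul_sub, Finset.sum_sub_distrib, Finset.smul_sum, pow_succ,
          Matrix.mul_apply, Finset.sum_smul, smul_smul]
        rw [Finset.sum_comm]
        simp_rw [mul_comm (α k)]
      rw [e1, hs]
      have h1 := ih (m + 1) i
      have h2 : ‖α k • ∑ j, (N ^ m) i j • h k j‖ ≤ α k * (C * γ ^ m * H) := by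
        rw [norm_smul, Real.norm_of_nonneg (hα k)]
        refine mul_le_mul_of_nonneg_left ((hmat m _ i).trans ?_) (hα k)
        exact mul_le_mul_of_nonneg_left (hH k) (by positivity)
      refine (norm_sub_le _ _).trans ((add_le_add h1 h2).trans (le_of_eq ?_))
      rw [pow_succ]; ring
  have hsq : Summable fun k => s k ^ 2 := by
    refine summable_sq_of_affine_recursion hγ0.le hγ1 hs ?_
    simp_rw [mul_pow]
    exact hα2.mul_left _
  refine ⟨fun k => C * s k, fun k => mul_nonneg hC (hs0 k), ?_, fun k i => ?_⟩
  · simp_rw [mul_pow]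
    exact hsq.mul_left _
  · simpa [Matrix.one_apply] using key k 0 i

end PerturbedContraction

/-! ### Quasi-Fejér monotone sequences. -/

section QuasiFejer

lemma exists_tendsto_of_le_add_summable {a η : ℕ → ℝ} (ha : ∀ k, 0 ≤ a k) (hη0 : ∀ k, 0 ≤ η k)
    (hη : Summable η) (h : ∀ k, a (k + 1) ≤ a k + η k) : ∃ l, Tendsto a atTop (𝓝 l) := by
  have hanti : Antitone fun k => a k - ∑ j ∈ Finset.range k, η j := by
    refine antitone_nat_of_succ_le fun k => ?_
    rw [Finset.sum_range_succ]
    linarith [h k]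
  have hbdd : BddBelow (Set.range fun k => a k - ∑ j ∈ Finset.range k, η j) := by
    refine ⟨-∑' j, η j, ?_⟩
    rintro _ ⟨k, rfl⟩
    have := hη.sum_le_tsum (Finset.range k) (fun j _ => hη0 j)
    dsimp only
    linarith [ha k]
  have h1 := tendsto_atTop_ciInf hanti hbdd
  have h2 := h1.add hη.hasSum.tendsto_sum_nat
  exact ⟨_, by simpa using h2⟩

/-- Telescoping bounds `∑ α_k φ_k`. If `φ` were eventually at least `δ`, this would bound `∑ α_k` as
well. -/
lemma frequently_lt_of_divergent_weights {a η α φ : ℕ → ℝ} (ha : ∀ k, 0 ≤ a k)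
    (hη0 : ∀ k, 0 ≤ η k) (hη : Summable η) (hα : ∀ k, 0 ≤ α k)
    (hα_sum : Tendsto (fun K => ∑ k ∈ Finset.range K, α k) atTop atTop) (hφ : ∀ k, 0 ≤ φ k)
    {c : ℝ} (hc : 0 < c) (h : ∀ k, a (k + 1) + c * α k * φ k ≤ a k + η k) {δ : ℝ} (hδ : 0 < δ) :
    ∃ᶠ k in atTop, φ k < δ := by
  intro hcon
  obtain ⟨K₀, hK₀⟩ := eventually_atTop.1 hcon
  have hsum : ∀ K, ∑ k ∈ Finset.range K, c * α k * φ k ≤ a 0 + ∑' k, η k := by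
    intro K
    have h1 : a K + ∑ k ∈ Finset.range K, c * α k * φ k ≤ a 0 + ∑ k ∈ Finset.range K, η k := by
      induction K with
      | zero => simp
      | succ K ih => rw [Finset.sum_range_succ, Finset.sum_range_succ]; linarith [h K]
    linarith [ha K, hη.sum_le_tsum (Finset.range K) (fun j _ => hη0 j)]
  have hbound : ∀ K, c * δ * ∑ k ∈ Finset.range K, α k
      ≤ a 0 + ∑' k, η k + c * δ * ∑ k ∈ Finset.range K₀, α k := by
    intro K
    have hterm : ∀ k, c * δ * α k ≤ c * α k * φ k + (if k < K₀ then c * δ * α k else 0) := by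
      intro k
      have h0 : 0 ≤ c * α k := mul_nonneg hc.le (hα k)
      split_ifs with hk
      · have := mul_nonneg h0 (hφ k); linarith
      · have := not_lt.1 (hK₀ k (not_lt.1 hk))
        nlinarith
    rw [Finset.mul_sum, Finset.mul_sum]
    refine (Finset.sum_le_sum fun k _ => hterm k).trans ?_
    rw [Finset.sum_add_distrib]
    refine add_le_add (hsum K) ?_
    rw [← Finset.sum_filter]
    refine Finset.sum_le_sum_of_subset_of_nonneg (fun k hk => ?_) fun k _ _ => ?_
    · exact Finset.mem_range.2 (Finset.mem_filter.1 hk).2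
    · exact mul_nonneg (by positivity) (hα k)
  have hcδ : 0 < c * δ := mul_pos hc hδ
  obtain ⟨K, hK⟩ := (hα_sum.eventually_gt_atTop
    ((a 0 + ∑' k, η k + c * δ * ∑ k ∈ Finset.range K₀, α k) / (c * δ))).exists
  rw [div_lt_iff₀ hcδ] at hK
  linarith [hbound K]

/-- Convergence of a quasi-Fejér monotone sequence to a minimizer. -/
lemma exists_minimizer_tendsto_of_quasiFejer {E : Type*} [NormedAddCommGroup E] [ProperSpace E]
    {F : E → ℝ} (hF : Continuous F) {m : ℝ} (hm : IsLeast (Set.range F) m) {x : ℕ → E}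
    {η α : ℕ → ℝ} (hη0 : ∀ k, 0 ≤ η k) (hη : Summable η) (hα : ∀ k, 0 ≤ α k)
    (hα_sum : Tendsto (fun K => ∑ k ∈ Finset.range K, α k) atTop atTop) {c : ℝ} (hc : 0 < c)
    (h : ∀ y, F y = m → ∀ k,
      ‖x (k + 1) - y‖ ^ 2 + c * α k * (F (x k) - m) ≤ ‖x k - y‖ ^ 2 + η k) :
    ∃ y, F y = m ∧ Tendsto x atTop (𝓝 y) := by
  have hφ : ∀ k, 0 ≤ F (x k) - m := fun k => sub_nonneg.2 (hm.2 ⟨x k, rfl⟩)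
  have hconv : ∀ y, F y = m → ∃ l, Tendsto (fun k => ‖x k - y‖ ^ 2) atTop (𝓝 l) := fun y hy =>
    exists_tendsto_of_le_add_summable (fun _ => sq_nonneg _) hη0 hη fun k => by
      have := mul_nonneg (mul_nonneg hc.le (hα k)) (hφ k)
      linarith [h y hy k]
  obtain ⟨y₀, hy₀⟩ := hm.1
  have hfreq : ∀ j : ℕ, ∃ᶠ k in atTop, F (x k) - m < 1 / ((j : ℝ) + 1) := fun j =>
    frequently_lt_of_divergent_weights (fun k => sq_nonneg ‖x k - y₀‖) hη0 hη hα hα_sum hφ hc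
      (h y₀ hy₀) (by positivity)
  obtain ⟨ψ, hψ, hψF⟩ := extraction_forall_of_frequently hfreq
  obtain ⟨l, hl⟩ := hconv y₀ hy₀
  obtain ⟨b, hb⟩ := hl.bddAbove_range
  have hmem : ∀ j, x (ψ j) ∈ Metric.closedBall y₀ (Real.sqrt b) := by
    intro j
    rw [Metric.mem_closedBall, dist_eq_norm]
    exact Real.le_sqrt_of_sq_le (hb ⟨ψ j, rfl⟩)
  obtain ⟨y, -, θ, hθ, hy⟩ := (isCompact_closedBall y₀ (Real.sqrt b)).tendsto_subseq hmem
  have hFlim : Tendsto (fun j => F (x (ψ (θ j))) - m) atTop (𝓝 (F y - m)) :=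
    ((hF.tendsto y).comp hy).sub_const m
  have hF0 : Tendsto (fun j => F (x (ψ (θ j))) - m) atTop (𝓝 0) := by
    refine squeeze_zero (fun j => hφ _) (fun j => (hψF (θ j)).le) ?_
    exact tendsto_one_div_add_atTop_nhds_zero_nat.comp hθ.tendsto_atTop
  have hFy : F y = m := sub_eq_zero.1 (tendsto_nhds_unique hFlim hF0)
  -- The cluster point is itself a minimizer, so the whole sequence of distances to it converges.
  -- Its limit is 0 along the subsequence.
  obtain ⟨l', hl'⟩ := hconv y hFy
  have h1 : Tendsto (fun j => ‖x (ψ (θ j)) - y‖ ^ 2) atTop (𝓝 l') :=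
    hl'.comp (hψ.comp hθ).tendsto_atTop
  have h2 : Tendsto (fun j => ‖x (ψ (θ j)) - y‖ ^ 2) atTop (𝓝 0) := by
    have := (tendsto_iff_norm_sub_tendsto_zero.1 hy).pow 2
    simpa using this
  rw [tendsto_nhds_unique h1 h2] at hl'
  refine ⟨y, hFy, tendsto_iff_norm_sub_tendsto_zero.2 ?_⟩
  simpa [Real.sqrt_sq] using hl'.sqrt

end QuasiFejer

/-! ### The average and the consensus error along the iteration. -/

section Iteration

variable {n p : ℕ}

/-- The average of all `2 n` states over the `n` agents. -/
noncomputable def networkAverage (x : Fin n ⊕ Fin n → EuclideanSpace ℝ (Fin p)) :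
    EuclideanSpace ℝ (Fin p) :=
  (1 / (n : ℝ)) • ∑ i, x i

/-- The deviation of the states from the consensus state with the same average. -/
noncomputable def consensusError (x : Fin n ⊕ Fin n → EuclideanSpace ℝ (Fin p))
    (i : Fin n ⊕ Fin n) : EuclideanSpace ℝ (Fin p) :=
  x i - Sum.elim (fun _ => (1 : ℝ)) (fun _ => 0) i • networkAverage x

lemma sum_consensusProjection_smul (x : Fin n ⊕ Fin n → EuclideanSpace ℝ (Fin p))
    (i : Fin n ⊕ Fin n) :
    ∑ j, consensusProjection n i j • x j
      = Sum.elim (fun _ => (1 : ℝ)) (fun _ => 0) i • networkAverage x := by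
  rcases i with i | i
  · simp [consensusProjection, networkAverage, Finset.smul_sum]
  · simp [consensusProjection]

variable {A B : Matrix (Fin n) (Fin n) ℝ}

lemma networkAverage_step (hB : ∀ j, ∑ i, B i j = 1) {ε a : ℝ}
    {x y g : Fin n ⊕ Fin n → EuclideanSpace ℝ (Fin p)}
    (h : ∀ i, y i = ∑ j, weightMatrix A B ε i j • x j - a • g i) :
    networkAverage y = networkAverage x - a • networkAverage g := by
  simp_rw [networkAverage, h]
  rw [Finset.sum_sub_distrib, Finset.sum_comm]
  simp_rw [← Finset.sum_smul, sum_weightMatrix_col hB, one_smul]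
  rw [← Finset.smul_sum, smul_sub, smul_comm]

/-- `M` and `P` both fix the consensus direction, so `M - P` kills it and only the error of `x`
survives. -/
lemma consensusError_step [Nonempty (Fin n)] (hA : ∀ i, ∑ j, A i j = 1)
    (hB : ∀ j, ∑ i, B i j = 1) {ε a : ℝ}
    {x y g : Fin n ⊕ Fin n → EuclideanSpace ℝ (Fin p)}
    (h : ∀ i, y i = ∑ j, weightMatrix A B ε i j • x j - a • g i) (i : Fin n ⊕ Fin n) :
    consensusError y i
      = ∑ j, (weightMatrix A B ε - consensusProjection n) i j • consensusError x j
        - a • consensusError g i := by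
  have hn : (n : ℝ) ≠ 0 := by
    exact_mod_cast (Fin.pos_iff_nonempty.2 inferInstance : 0 < n).ne'
  set δ : Fin n ⊕ Fin n → ℝ := Sum.elim (fun _ => 1) (fun _ => 0) with hδ
  have h1 : ∑ j, (weightMatrix A B ε - consensusProjection n) i j * δ j = 0 := by
    rw [Fintype.sum_sum_type]
    simp only [hδ, Sum.elim_inl, Sum.elim_inr, mul_one, mul_zero, Finset.sum_const_zero, add_zero,
      Matrix.sub_apply, Finset.sum_sub_distrib, sum_weightMatrix_inl_row hA]
    rcases i with i | i <;> simp [consensusProjection, hn]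
  have h2 : ∑ j, (weightMatrix A B ε - consensusProjection n) i j • consensusError x j
      = ∑ j, weightMatrix A B ε i j • x j - δ i • networkAverage x := by
    simp only [consensusError, smul_sub, Finset.sum_sub_distrib, smul_smul, ← Finset.sum_smul]
    rw [h1, zero_smul, sub_zero]
    simp only [Matrix.sub_apply, sub_smul, Finset.sum_sub_distrib]
    rw [sum_consensusProjection_smul]
  rw [h2, consensusError, consensusError, networkAverage_step hB h, h i]
  simp only [smul_sub, smul_comm a]
  abel

lemma sum_norm_consensusError_le [Nonempty (Fin n)]
    (g : Fin n ⊕ Fin n → EuclideanSpace ℝ (Fin p)) :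
    ∑ i, ‖consensusError g i‖ ≤ 2 * ∑ i, ‖g i‖ := by
  have hn : (0 : ℝ) < n := by
    exact_mod_cast (Fin.pos_iff_nonempty.2 inferInstance : 0 < n)
  have havg : ‖networkAverage g‖ ≤ 1 / n * ∑ i, ‖g i‖ := by
    rw [networkAverage, norm_smul, Real.norm_of_nonneg (by positivity)]
    exact mul_le_mul_of_nonneg_left (norm_sum_le _ _) (by positivity)
  calc ∑ i, ‖consensusError g i‖
      ≤ ∑ i, (‖g i‖ + Sum.elim (fun _ => (1 : ℝ)) (fun _ => 0) i * ‖networkAverage g‖) := by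
        refine Finset.sum_le_sum fun i _ => (norm_sub_le _ _).trans (le_of_eq ?_)
        rw [norm_smul]
        rcases i with i | i <;> simp
    _ = ∑ i, ‖g i‖ + n * ‖networkAverage g‖ := by
        rw [Finset.sum_add_distrib, ← Finset.sum_mul, Fintype.sum_sum_type
          (fun i : Fin n ⊕ Fin n => Sum.elim (fun _ => (1 : ℝ)) (fun _ => 0) i)]
        simp
    _ ≤ ∑ i, ‖g i‖ + n * (1 / n * ∑ i, ‖g i‖) := by gcongr
    _ = 2 * ∑ i, ‖g i‖ := by field_simp; ring

lemma continuous_globalObjective {f : Fin n → EuclideanSpace ℝ (Fin p) → ℝ}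
    (hconv : ∀ i, ConvexOn ℝ Set.univ (f i)) : Continuous (globalObjective f) :=
  continuous_finsetSum _ fun i _ => (hconv i).locallyLipschitz.continuous

/-- The basic inequality of the subgradient step at approximately evaluated points. -/
lemma inner_sum_subgradient_ge {f : Fin n → EuclideanSpace ℝ (Fin p) → ℝ}
    (hconv : ∀ i, ConvexOn ℝ Set.univ (f i)) {D : ℝ}
    (hD : ∀ i x g, IsSubgradientAt (f i) x g → ‖g‖ ≤ D)
    {x g : Fin n → EuclideanSpace ℝ (Fin p)} (hg : ∀ i, IsSubgradientAt (f i) (x i) (g i))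
    {w : EuclideanSpace ℝ (Fin p)} {s : ℝ} (hs : ∀ i, ‖x i - w‖ ≤ s)
    (y : EuclideanSpace ℝ (Fin p)) :
    globalObjective f w - globalObjective f y - n * (2 * D * s) ≤ inner ℝ (∑ i, g i) (w - y) := by
  have hterm : ∀ i, f i w - f i y - 2 * D * s ≤ inner ℝ (g i) (w - y) := by
    intro i
    have h1 := hg i y
    have hDi := hD i _ _ (hg i)
    have hD0 : 0 ≤ D := (norm_nonneg _).trans hDi
    -- The subgradient is taken at `x i`, not at `w`. Moving the value of `f i` and the inner
    -- product to `w` costs `D * s` each, whence `2 * D * s`.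
    have h2 := (hconv i).sub_le_of_subgradient_norm_le (hD i) w (x i)
    have h3 : inner ℝ (g i) (w - y) = inner ℝ (g i) (w - x i) - inner ℝ (g i) (y - x i) := by
      rw [← inner_sub_right]; congr 1; abel
    have h4 := abs_real_inner_le_norm (g i) (w - x i)
    have h5 : ‖w - x i‖ ≤ s := by rw [norm_sub_rev]; exact hs i
    have h6 : ‖g i‖ * ‖w - x i‖ ≤ D * s := mul_le_mul hDi h5 (norm_nonneg _) hD0
    have h7 : D * ‖w - x i‖ ≤ D * s := mul_le_mul_of_nonneg_left h5 hD0
    have h8 := neg_abs_le (inner ℝ (g i) (w - x i))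
    linarith
  rw [sum_inner, globalObjective, globalObjective, ← Finset.sum_sub_distrib]
  calc _ = ∑ i, (f i w - f i y - 2 * D * s) := by
        rw [Finset.sum_sub_distrib (g := fun _ => 2 * D * s)]; simp
    _ ≤ _ := Finset.sum_le_sum fun i _ => hterm i

end Iteration

/-! ### Convergence of the iteration. -/

theorem mainTheorem1 {n p : ℕ} (G : Digraph (Fin n)) (hG : IsStronglyConnectedDigraph G)
    (A B : Matrix (Fin n) (Fin n) ℝ) (hA : IsRowWeightMatrix G A) (hB : IsColWeightMatrix G B)
    (ε : ℝ) (hε_pos : 0 < ε) (hε_lt : ε < epsilonBound A B)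
    (f : Fin n → EuclideanSpace ℝ (Fin p) → ℝ)
    (hconv : ∀ i, ConvexOn ℝ Set.univ (f i))
    (D : ℝ) (hD : ∀ i x g, IsSubgradientAt (f i) x g → ‖g‖ ≤ D)
    (fstar : ℝ) (hfstar : IsLeast (Set.range (globalObjective f)) fstar)
    (α : ℕ → ℝ) (hα_nonneg : ∀ k, 0 ≤ α k)
    (hα_sum : Tendsto (fun K => ∑ k ∈ Finset.range K, α k) atTop atTop)
    (hα_sq : Summable (fun k => α k ^ 2))
    (z : ℕ → Fin n ⊕ Fin n → EuclideanSpace ℝ (Fin p))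
    (hz : IsDDGDSequence f A B ε α z) :
    ∀ i : Fin n, Tendsto (fun k => globalObjective f (z k (Sum.inl i))) atTop (𝓝 fstar) := by
  intro i₀
  have : Nonempty (Fin n) := ⟨i₀⟩
  have hn : (0 : ℝ) < n := by
    exact_mod_cast (Fin.pos_iff_nonempty.2 inferInstance : 0 < n)
  obtain ⟨g, hg, hstep⟩ := hz
  have hgD : ∀ k i, ‖g k i‖ ≤ D := fun k i => hD i _ _ (hg k i)
  have hD0 : 0 ≤ D := (norm_nonneg _).trans (hgD 0 i₀)
  set γ' : ℕ → Fin n ⊕ Fin n → EuclideanSpace ℝ (Fin p) :=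
    fun k => Sum.elim (g k) (fun _ => 0) with hγ'
  obtain ⟨C, γ, hC, hγ0, hγ1, hpow⟩ := exists_consensus_error_pow_le hG hA hB hε_pos hε_lt
  have hsumg : ∀ k, ∑ i, ‖γ' k i‖ ≤ n * D := by
    intro k
    rw [Fintype.sum_sum_type]
    simp only [hγ', Sum.elim_inl, Sum.elim_inr, norm_zero, Finset.sum_const_zero, add_zero]
    refine (Finset.sum_le_sum fun i _ => hgD k i).trans (le_of_eq ?_)
    simp
  obtain ⟨s, hs0, hs2, hes⟩ := exists_square_summable_bound hC hγ0 hγ1 hpow hα_nonneg hα_sq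
    (e := fun k => consensusError (z k)) (h := fun k => consensusError (γ' k))
    (fun k i => consensusError_step hA.row_sum hB.col_sum (hstep k) i)
    (H := 2 * (n * D)) (by positivity)
    (fun k => (sum_norm_consensusError_le _).trans
      (mul_le_mul_of_nonneg_left (hsumg k) zero_le_two))
  have hdev : ∀ k i, ‖z k (Sum.inl i) - networkAverage (z k)‖ ≤ s k := by
    intro k i
    simpa [consensusError] using hes k (Sum.inl i)
  have havg : ∀ k, networkAverage (γ' k) = (1 / (n : ℝ)) • ∑ i, g k i := by
    intro k
    rw [networkAverage, Fintype.sum_sum_type]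
    simp [hγ']
  have havgn : ∀ k, ‖networkAverage (γ' k)‖ ≤ D := by
    intro k
    rw [networkAverage, norm_smul, Real.norm_of_nonneg (by positivity), one_div,
      inv_mul_le_iff₀ hn]
    exact (norm_sum_le _ _).trans (hsumg k)
  -- Expanding `‖avg - y - α k • avg g‖²` leaves two error terms: `4Dαs` from evaluating
  -- subgradients off the average, and `D²α²` from the squared step.
  have hη : Summable fun k => 4 * D * (α k * s k) + D ^ 2 * α k ^ 2 := by
    refine Summable.add (Summable.mul_left _ ?_) (hα_sq.mul_left _)
    refine Summable.of_nonneg_of_le (fun k => mul_nonneg (hα_nonneg k) (hs0 k)) (fun k => ?_)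
      (hα_sq.add hs2)
    nlinarith [sq_nonneg (α k - s k), sq_nonneg (α k), sq_nonneg (s k)]
  obtain ⟨y, hy, hlim⟩ := exists_minimizer_tendsto_of_quasiFejer
    (continuous_globalObjective hconv) hfstar (x := fun k => networkAverage (z k))
    (fun k => add_nonneg (mul_nonneg (by positivity) (mul_nonneg (hα_nonneg k) (hs0 k)))
      (by positivity)) hη hα_nonneg hα_sum (c := 2 / n) (by positivity) (fun y hy k => by
      have h1 := inner_sum_subgradient_ge hconv hD (hg k) (hdev k) y
      rw [hy] at h1
      set I := inner ℝ (∑ i, g k i) (networkAverage (z k) - y) with hI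
      set φ := globalObjective f (networkAverage (z k)) - fstar with hφ
      have h2 : 1 / (n : ℝ) * φ - 2 * D * s k ≤ 1 / (n : ℝ) * I := by
        have h3 := mul_le_mul_of_nonneg_left h1 (by positivity : 0 ≤ 1 / (n : ℝ))
        rw [mul_sub, ← mul_assoc (1 / (n : ℝ)) (n : ℝ), one_div_mul_cancel hn.ne', one_mul] at h3
        exact h3
      have h4 : inner ℝ (networkAverage (z k) - y) (α k • networkAverage (γ' k))
          = α k * (1 / (n : ℝ) * I) := by
        rw [inner_smul_right, havg, inner_smul_right, real_inner_comm]
      have h5 : ‖α k • networkAverage (γ' k)‖ ^ 2 ≤ D ^ 2 * α k ^ 2 := by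
        rw [norm_smul, Real.norm_of_nonneg (hα_nonneg k), mul_pow, mul_comm]
        have := havgn k
        gcongr
      rw [networkAverage_step hB.col_sum (hstep k), sub_right_comm, norm_sub_sq_real, h4]
      have h6 := mul_le_mul_of_nonneg_left h2 (hα_nonneg k)
      have h7 : 2 / (n : ℝ) * α k * φ = 2 * (α k * (1 / (n : ℝ) * φ)) := by ring
      rw [h7]
      linarith)
  have hs_lim : Tendsto s atTop (𝓝 0) := by
    have := hs2.tendsto_atTop_zero.sqrt
    simpa [Real.sqrt_sq (hs0 _)] using this
  have hz_lim : Tendsto (fun k => z k (Sum.inl i₀)) atTop (𝓝 y) := by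
    have h1 : Tendsto (fun k => z k (Sum.inl i₀) - networkAverage (z k)) atTop (𝓝 0) :=
      squeeze_zero_norm (fun k => hdev k i₀) hs_lim
    simpa using h1.add hlim
  rw [← hy]
  exact ((continuous_globalObjective hconv).tendsto y).comp hz_lim
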